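/- Let $M$ be an $n$-dimensional smooth manifold with a smooth volume $dx$, let $X_1,\dots,X_N$ be smooth vector fields on $M$ with formal adjoints $X_k^*$ with respect to $dx$, and put $\nabla_X=(X_1,\dots,X_N)$. Let $\Omega\subset M$ be a nonempty open set (for instance a bounded domain with smooth boundary), let $p:\Omega\to\mathbb{R}$ be a $C^1$ function with $1<p^-\le p(x)\le p^+<\infty$ on $\Omega$, and let $g:\Omega\to(0,\infty)$ be measurable and bounded. Let $L^{p(\cdot)}(\Omega)$ be the variable exponent Lebesgue space with its Luxemburg norm, let $W^{1,p(\cdot)}(\Omega)$ be the space of all $u\in L^{p(\cdot)}(\Omega)$ whose weak horizontal gradient $\nabla_Xu$ (defined by $\int_\Omega u\,X_k^*\varphi\,dx=\int_\Omega (X_ku)\,\varphi\,dx$ for all $\varphi\in C_0^\infty(\Omega)$ and all $k$) satisfies $|\nabla_Xu|\in L^{p(\cdot)}(\Omega)$, with the norm $\|u\|_{L^{p(\cdot)}(\Omega)}+\|\nabla_Xu\|_{L^{p(\cdot)}(\Omega)}$, and let $W_0^{1,p(\cdot)}(\Omega)$ be the closure of $C_0^\infty(\Omega)$ in $W^{1,p(\cdot)}(\Omega)$.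 For $\lambda\in\mathbb{R}$ consider the weighted Dirichlet problem $$\nabla_X^*\cdot\big(|\nabla_Xu|^{p(x)-2}\nabla_Xu\big)=\sum_{k=1}^N X_k^*\big(|\nabla_Xu|^{p(x)-2}X_ku\big)=\lambda\,g(x)|u|^{p(x)-2}u\ \text{ in }\Omega,\qquad u=0\ \text{ on }\partial\Omega .$$ A function $v\in W_0^{1,p(\cdot)}(\Omega)$ is a sup-solution of it if $$\int_\Omega|\nabla_Xv|^{p(x)-2}\langle\nabla_Xv,\nabla_X\phi\rangle\,dx-\lambda\int_\Omega g(x)|v|^{p(x)-2}v\,\phi\,dx\ge 0\qquad\text{for all } \phi\in W_0^{1,p(\cdot)}(\Omega) \text{ with } \phi\ge 0 ,$$ and $\lambda$ is an eigenvalue if there is a nonzero $u\in W_0^{1,p(\cdot)}(\Omega)$ such that this expression, with $u$ in place of $v$, vanishes for all $\phi\in W_0^{1,p(\cdot)}(\Omega)$. Put $$\lambda_{1,p}(\Omega)=\inf_{u\in W_0^{1,p(\cdot)}(\Omega)\setminus\{0\}}\frac{\int_\Omega|\nabla_Xu|^{p(x)}\,dx}{\int_\Omega g(x)|u|^{p(x)}\,dx}.$$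 Proposition. Let $\lambda\in\mathbb{R}$, and suppose that there is a sup-solution $v\in W_0^{1,p(\cdot)}(\Omega)$ of the problem for $\lambda$ with $v>0$ and $\langle\nabla_Xp,\nabla_Xv\rangle=0$ a.e. in $\Omega$. Then $$\int_\Omega|\nabla_Xu|^{p(x)}\,dx\ \ge\ \lambda\int_\Omega g(x)|u|^{p(x)}\,dx\qquad\text{for all }u\in W_0^{1,p(\cdot)}(\Omega),$$ and $\lambda_{1,p}(\Omega)\ge\lambda$. Moreover every eigenvalue $\lambda'$ of the problem satisfies $\lambda'\ge\lambda$. -/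

import Mathlib

open MeasureTheory Filter Topology
open scoped Manifold ContDiff

noncomputable section

namespace VarExp

/-- `μ` is the measure of a smooth volume on the `n`-dimensional manifold `M`: in every chart of
the atlas it has a smooth, strictly positive density with respect to Lebesgue measure. -/
def IsSmoothVolume (n : ℕ) {M : Type*} [TopologicalSpace M]
    [ChartedSpace (EuclideanSpace ℝ (Fin n)) M] [MeasurableSpace M] (μ : Measure M) : Prop :=
  ∀ e ∈ atlas (EuclideanSpace ℝ (Fin n)) M, ∃ ρ : EuclideanSpace ℝ (Fin n) → ℝ,
    ContDiffOn ℝ ∞ ρ e.target ∧ (∀ y ∈ e.target, 0 < ρ y) ∧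
    ∀ s ⊆ e.source, MeasurableSet s → μ s = ∫⁻ y in e '' s, ENNReal.ofReal (ρ y)

section Horizontal

variable {n N : ℕ} {M : Type*} [TopologicalSpace M]
  [ChartedSpace (EuclideanSpace ℝ (Fin n)) M]

/-- The family `X₁, …, X_N` consists of smooth vector fields on `M`. -/
def SmoothFields (X : Fin N → (x : M) → TangentSpace (𝓡 n) x) [IsManifold (𝓡 n) ∞ M] : Prop :=
  ∀ k, ContMDiff (𝓡 n) (𝓡 n).tangent ∞ (fun x => (⟨x, X k x⟩ : TangentBundle (𝓡 n) M))

/-- The classical horizontal gradient `∇_X f = (X₁ f, …, X_N f)` of a differentiable function. -/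
def hGrad (X : Fin N → (x : M) → TangentSpace (𝓡 n) x) (f : M → ℝ) (x : M) :
    EuclideanSpace ℝ (Fin N) :=
  WithLp.toLp 2 (fun k => (mfderiv (𝓡 n) 𝓘(ℝ, ℝ) f x (X k x) : ℝ))

/-- `φ ∈ C₀^∞(Ω)`: smooth with compact support contained in `Ω`. -/
def IsTest (n : ℕ) {M : Type*} [TopologicalSpace M]
    [ChartedSpace (EuclideanSpace ℝ (Fin n)) M] (Ω : Set M) (φ : M → ℝ) : Prop :=
  ContMDiff (𝓡 n) 𝓘(ℝ, ℝ) ∞ φ ∧ HasCompactSupport φ ∧ tsupport φ ⊆ Ω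

variable [MeasurableSpace M]

/-- `ψ = X_k^* φ`, where `X_k^*` is the formal adjoint of `X_k` with respect to `μ`:
`∫ φ X_k η dμ = ∫ ψ η dμ` for all `η ∈ C₀^∞(M)`. For smooth `X_k`, a smooth volume `μ` and
`φ ∈ C₀^∞(M)` there is exactly one continuous `ψ` with this property; it is smooth with compact
support, and `ψ = - ρ⁻¹ ∑ⱼ ∂ⱼ (ρ a_{kj} φ)` in coordinates in which `X_k = ∑ⱼ a_{kj} ∂ⱼ` and
`dμ = ρ dx`. -/
def IsAdjointOf (μ : Measure M) (X : Fin N → (x : M) → TangentSpace (𝓡 n) x) (k : Fin N)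
    (φ ψ : M → ℝ) : Prop :=
  ∀ η : M → ℝ, IsTest n Set.univ η → ∫ x, φ x * hGrad X η x k ∂μ = ∫ x, ψ x * η x ∂μ

/-- `w = ∇_X u` in `Ω` in the weak sense: `∫_Ω u X_k^* φ dμ = ∫_Ω w_k φ dμ` for every
`φ ∈ C₀^∞(Ω)` and every `k`. -/
def IsWeakHGrad (μ : Measure M) (X : Fin N → (x : M) → TangentSpace (𝓡 n) x) (Ω : Set M)
    (u : M → ℝ) (w : M → EuclideanSpace ℝ (Fin N)) : Prop :=
  ∀ k, ∀ φ ψ : M → ℝ, IsTest n Ω φ → IsTest n Set.univ ψ → IsAdjointOf μ X k φ ψ →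
    ∫ x in Ω, u x * ψ x ∂μ = ∫ x in Ω, w x k * φ x ∂μ

end Horizontal

section Spaces

variable {M : Type*} [MeasurableSpace M] {F : Type*} [NormedAddCommGroup F] [NormedSpace ℝ F]

/-- The modular `∫_Ω |f|^{p(x)} dμ`, with values in `[0, ∞]`. -/
def modular (μ : Measure M) (Ω : Set M) (p : M → ℝ) (f : M → F) : ENNReal :=
  ∫⁻ x in Ω, ENNReal.ofReal (‖f x‖ ^ p x) ∂μ

/-- `f ∈ L^{p(·)}(Ω)`. -/
def MemVarLp (μ : Measure M) (Ω : Set M) (p : M → ℝ) (f : M → F) : Prop :=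
  AEStronglyMeasurable f (μ.restrict Ω) ∧ modular μ Ω p f < ⊤

/-- The Luxemburg norm of `L^{p(·)}(Ω)`. -/
def luxNorm (μ : Measure M) (Ω : Set M) (p : M → ℝ) (f : M → F) : ℝ :=
  sInf {t : ℝ | 0 < t ∧ modular μ Ω p (fun x => t⁻¹ • f x) ≤ 1}

end Spaces

section Eigenvalue

variable {n N : ℕ} {M : Type*} [TopologicalSpace M]
  [ChartedSpace (EuclideanSpace ℝ (Fin n)) M] [MeasurableSpace M]

/-- `u ∈ W^{1,p(·)}(Ω)` with (weak) horizontal gradient `w = ∇_X u`. -/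
def MemW (μ : Measure M) (X : Fin N → (x : M) → TangentSpace (𝓡 n) x) (Ω : Set M) (p : M → ℝ)
    (u : M → ℝ) (w : M → EuclideanSpace ℝ (Fin N)) : Prop :=
  MemVarLp μ Ω p u ∧ MemVarLp μ Ω p w ∧ IsWeakHGrad μ X Ω u w

/-- `u ∈ W₀^{1,p(·)}(Ω)` with horizontal gradient `w = ∇_X u`: the function `u` lies in the closure
of `C₀^∞(Ω)` in `W^{1,p(·)}(Ω)`. -/
def MemW0 (μ : Measure M) (X : Fin N → (x : M) → TangentSpace (𝓡 n) x) (Ω : Set M) (p : M → ℝ)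
    (u : M → ℝ) (w : M → EuclideanSpace ℝ (Fin N)) : Prop :=
  MemW μ X Ω p u w ∧ ∃ φ : ℕ → M → ℝ, (∀ i, IsTest n Ω (φ i)) ∧
    Tendsto (fun i => luxNorm μ Ω p (fun x => u x - φ i x) +
      luxNorm μ Ω p (fun x => w x - hGrad X (φ i) x)) atTop (𝓝 0)

/-- The weak form
`∫_Ω |∇_X u|^{p(x)-2} ⟨∇_X u, ∇_X φ⟩ dμ - lam ∫_Ω g |u|^{p(x)-2} u φ dμ`,
with `w = ∇_X u` and `ζ = ∇_X φ`. -/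
def weakForm (μ : Measure M) (Ω : Set M) (p g : M → ℝ) (lam : ℝ) (u : M → ℝ)
    (w : M → EuclideanSpace ℝ (Fin N)) (φ : M → ℝ) (ζ : M → EuclideanSpace ℝ (Fin N)) : ℝ :=
  (∫ x in Ω, ‖w x‖ ^ (p x - 2) * inner ℝ (w x) (ζ x) ∂μ) -
    lam * ∫ x in Ω, g x * |u x| ^ (p x - 2) * u x * φ x ∂μ

/-- `(u, lam)` is a sup-solution of the weighted Dirichlet eigenvalue problem:
`u ∈ W₀^{1,p(·)}(Ω)`, and the weak form is `≥ 0` on all nonnegative `φ ∈ W₀^{1,p(·)}(Ω)`. -/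
def IsSupSolution (μ : Measure M) (X : Fin N → (x : M) → TangentSpace (𝓡 n) x) (Ω : Set M)
    (p g : M → ℝ) (lam : ℝ) (u : M → ℝ) (w : M → EuclideanSpace ℝ (Fin N)) : Prop :=
  MemW0 μ X Ω p u w ∧ ∀ φ ζ, MemW0 μ X Ω p φ ζ → (∀ᵐ x ∂(μ.restrict Ω), 0 ≤ φ x) →
    0 ≤ weakForm μ Ω p g lam u w φ ζ

/-- `lam` is an eigenvalue of the weighted Dirichlet eigenvalue problem: the weak equation has a
solution `u ∈ W₀^{1,p(·)}(Ω) \ {0}`. -/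
def IsEigenvalue (μ : Measure M) (X : Fin N → (x : M) → TangentSpace (𝓡 n) x) (Ω : Set M)
    (p g : M → ℝ) (lam : ℝ) : Prop :=
  ∃ u w, MemW0 μ X Ω p u w ∧ ¬ u =ᵐ[μ.restrict Ω] 0 ∧
    ∀ φ ζ, MemW0 μ X Ω p φ ζ → weakForm μ Ω p g lam u w φ ζ = 0

/-- The principal frequency `λ_{1,p}(Ω)`, the infimum over `u ∈ W₀^{1,p(·)}(Ω) \ {0}` of
`∫_Ω |∇_X u|^{p(x)} dμ / ∫_Ω g |u|^{p(x)} dμ`. -/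
def principalFrequency (μ : Measure M) (X : Fin N → (x : M) → TangentSpace (𝓡 n) x) (Ω : Set M)
    (p g : M → ℝ) : ℝ :=
  sInf {r : ℝ | ∃ u w, MemW0 μ X Ω p u w ∧ ¬ u =ᵐ[μ.restrict Ω] 0 ∧
    r = (∫ x in Ω, ‖w x‖ ^ p x ∂μ) / ∫ x in Ω, g x * |u x| ^ p x ∂μ}

end Eigenvalue

end VarExp

end

/-!
The proof is a variable exponent form of Picone's identity. Let `v > 0` be the sup-solution and `φ`
a test function. The natural function to insert in the weak inequality for `v` is
`ψ = |φ|^p v^{1-p}`. Its horizontal gradient contains terms in `∇_X p`, coming from the variable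
exponents, but these are orthogonal to `∇_X v` by hypothesis. What remains of
`|∇_X v|^{p-2} ⟨∇_X v, ∇_X ψ⟩` is at most `|∇_X φ|^p` by Young's inequality, whereas the other term
of the weak form is `lam ∫ g |φ|^p`. The inequality for all of `W₀^{1,p(·)}(Ω)` follows by density.
The bound for `λ_{1,p}` is a restatement of it, `v` itself being an admissible function, and an
eigenvalue is compared with `lam` by testing its equation with the eigenfunction.

For `ψ` to be admissible it is regularized to
`((φ² + ε⁴)^{p/2} - ε^{2p}) (v + ε)^{1-p}` (`regPow`, `memW0_quotient`). All bases of powers are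
then positive, so that the chain rule applies without distinguishing the zeros of `φ`, the first
factor still has compact support, and the choice of the powers of `ε` makes the error in Picone's
inequality at most a multiple of `ε |∇_X v|^p`
(`picone_inequality`, `IsSupSolution.integral_le`). That this function belongs to
`W₀^{1,p(·)}(Ω)` is shown by replacing `v` by test functions `vᵢ → v`, and `v + ε` by
`ε + √(vᵢ² + ηᵢ)`. The approximants are `C¹` with compact support but no better, as `p` is
only `C¹`; they are approximated by test functions, uniformly with their gradients, using a
partition of unity and mollification in charts (`isTestLimit_of_contMDiff`).

Since the exponent is bounded, convergence in the Luxemburg norm is the same as convergence of the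
modular (`tendsto_luxNorm_of_modular`, `tendsto_modular_of_luxNorm`), and all limits are
taken in the modular. In particular a modular limit of test functions has a weak gradient
automatically (`memW0_of_modular_approx`).
-/

namespace VarExp

/-! ### Variable exponent modulars -/

section Modular

variable {M : Type*} [MeasurableSpace M] {F : Type*} [NormedAddCommGroup F]
  {μ : Measure M} {Ω : Set M} {p : M → ℝ} {pm pp : ℝ}

lemma modular_mono {G : Type*} [NormedAddCommGroup G]
    (hp : ∀ᵐ x ∂μ.restrict Ω, 0 ≤ p x) {f : M → F} {g : M → G}
    (h : ∀ᵐ x ∂μ.restrict Ω, ‖f x‖ ≤ ‖g x‖) : modular μ Ω p f ≤ modular μ Ω p g := by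
  refine lintegral_mono_ae ?_
  filter_upwards [hp, h] with x hx hle
  exact ENNReal.ofReal_le_ofReal (Real.rpow_le_rpow (norm_nonneg _) hle hx)

lemma aemeasurable_norm_rpow (hpm : AEMeasurable p (μ.restrict Ω)) {f : M → F}
    (hf : AEStronglyMeasurable f (μ.restrict Ω)) :
    AEMeasurable (fun x => ‖f x‖ ^ p x) (μ.restrict Ω) :=
  hf.norm.aemeasurable.pow hpm

lemma modular_smul_le [NormedSpace ℝ F] {c D : ℝ} (h : ∀ᵐ x ∂μ.restrict Ω, |c| ^ p x ≤ D)
    (hD : 0 ≤ D) (f : M → F) :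
    modular μ Ω p (fun x => c • f x) ≤ ENNReal.ofReal D * modular μ Ω p f := by
  unfold modular
  rw [← lintegral_const_mul' _ _ ENNReal.ofReal_ne_top]
  refine lintegral_mono_ae ?_
  filter_upwards [h] with x hx
  rw [← ENNReal.ofReal_mul hD, norm_smul, Real.mul_rpow (norm_nonneg _) (norm_nonneg _)]
  refine ENNReal.ofReal_le_ofReal (mul_le_mul_of_nonneg_right hx ?_)
  positivity

/-- The quasi-convexity of `a ↦ a ^ q`, with a constant close to `1` in front of the main term. -/
lemma add_rpow_le {a b t q Q : ℝ} (ha : 0 ≤ a) (hb : 0 ≤ b) (ht : 0 < t) (ht1 : t < 1)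
    (hq : 1 ≤ q) (hQ : q ≤ Q) :
    (a + b) ^ q ≤ (1 - t) ^ (1 - Q) * a ^ q + t ^ (1 - Q) * b ^ q := by
  have key : ∀ {s c : ℝ}, 0 < s → s < 1 → 0 ≤ c → s * (c / s) ^ q ≤ s ^ (1 - Q) * c ^ q := by
    intro s c hs hs1 hc
    rw [Real.div_rpow hc hs.le]
    have h1 : s * (c ^ q / s ^ q) = s ^ (1 - q) * c ^ q := by
      rw [Real.rpow_sub hs, Real.rpow_one]; ring
    rw [h1]
    exact mul_le_mul_of_nonneg_right
      (Real.rpow_le_rpow_of_exponent_ge hs hs1.le (by linarith)) (by positivity)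
  have hs : 0 < 1 - t := by linarith
  have hconv := (convexOn_rpow hq).2 (x := a / (1 - t)) (y := b / t)
    (Set.mem_Ici.2 (by positivity)) (Set.mem_Ici.2 (by positivity)) hs.le ht.le (by ring)
  simp only [smul_eq_mul] at hconv
  rw [mul_div_cancel₀ _ hs.ne', mul_div_cancel₀ _ ht.ne'] at hconv
  exact hconv.trans (add_le_add (key hs (by linarith) ha) (key ht ht1 hb))

lemma add_rpow_le_two {a b q Q : ℝ} (ha : 0 ≤ a) (hb : 0 ≤ b)
    (hq : 1 ≤ q) (hQ : q ≤ Q) : (a + b) ^ q ≤ 2 ^ Q * (a ^ q + b ^ q) := by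
  refine (add_rpow_le ha hb (t := 1 / 2) (by norm_num) (by norm_num) hq hQ).trans ?_
  have h : ((1 : ℝ) - 1 / 2) ^ (1 - Q) ≤ 2 ^ Q := by
    rw [show ((1 : ℝ) - 1 / 2) = 2⁻¹ by norm_num, Real.inv_rpow (by norm_num),
      ← Real.rpow_neg (by norm_num)]
    exact Real.rpow_le_rpow_of_exponent_le (by norm_num) (by linarith)
  have h' : ((1 : ℝ) / 2) ^ (1 - Q) ≤ 2 ^ Q := by
    rwa [show (1 : ℝ) - 1 / 2 = 1 / 2 by norm_num] at h
  rw [mul_add]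
  gcongr

lemma modular_add_le (hp : ∀ᵐ x ∂μ.restrict Ω, 1 ≤ p x ∧ p x ≤ pp)
    (hpm : AEMeasurable p (μ.restrict Ω)) {f g : M → F}
    (hf : AEStronglyMeasurable f (μ.restrict Ω)) :
    modular μ Ω p (fun x => f x + g x) ≤
      ENNReal.ofReal (2 ^ pp) * (modular μ Ω p f + modular μ Ω p g) := by
  unfold modular
  rw [← lintegral_add_left' (aemeasurable_norm_rpow hpm hf).ennreal_ofReal,
    ← lintegral_const_mul' _ _ ENNReal.ofReal_ne_top]
  refine lintegral_mono_ae ?_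
  filter_upwards [hp] with x hx
  rw [← ENNReal.ofReal_add (by positivity) (by positivity), ← ENNReal.ofReal_mul (by positivity)]
  refine ENNReal.ofReal_le_ofReal ?_
  refine (Real.rpow_le_rpow (norm_nonneg _) (norm_add_le _ _) (by linarith)).trans ?_
  exact add_rpow_le_two (norm_nonneg _) (norm_nonneg _) hx.1 hx.2

lemma modular_neg (f : M → F) : modular μ Ω p (fun x => -f x) = modular μ Ω p f := by
  simp [modular]

lemma MemVarLp.add (hp : ∀ᵐ x ∂μ.restrict Ω, 1 ≤ p x ∧ p x ≤ pp)
    (hpm : AEMeasurable p (μ.restrict Ω)) {f g : M → F}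
    (hf : MemVarLp μ Ω p f) (hg : MemVarLp μ Ω p g) : MemVarLp μ Ω p (fun x => f x + g x) :=
  ⟨hf.1.add hg.1, (modular_add_le hp hpm hf.1).trans_lt
    (ENNReal.mul_lt_top ENNReal.ofReal_lt_top (ENNReal.add_lt_top.2 ⟨hf.2, hg.2⟩))⟩

lemma MemVarLp.neg {f : M → F} (hf : MemVarLp μ Ω p f) : MemVarLp μ Ω p (fun x => -f x) :=
  ⟨hf.1.neg, by rw [modular_neg]; exact hf.2⟩

lemma MemVarLp.sub (hp : ∀ᵐ x ∂μ.restrict Ω, 1 ≤ p x ∧ p x ≤ pp)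
    (hpm : AEMeasurable p (μ.restrict Ω)) {f g : M → F}
    (hf : MemVarLp μ Ω p f) (hg : MemVarLp μ Ω p g) : MemVarLp μ Ω p (fun x => f x - g x) := by
  simpa [sub_eq_add_neg] using hf.add hp hpm hg.neg

lemma MemVarLp.integrable (hpm : AEMeasurable p (μ.restrict Ω)) {f : M → F}
    (hf : MemVarLp μ Ω p f) : Integrable (fun x => ‖f x‖ ^ p x) (μ.restrict Ω) := by
  refine ⟨(aemeasurable_norm_rpow hpm hf.1).aestronglyMeasurable, ?_⟩
  rw [hasFiniteIntegral_iff_ofReal (Eventually.of_forall fun x => by positivity)]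
  exact hf.2

lemma MemVarLp.integral_eq (hpm : AEMeasurable p (μ.restrict Ω)) {f : M → F}
    (hf : MemVarLp μ Ω p f) :
    ∫ x in Ω, ‖f x‖ ^ p x ∂μ = (modular μ Ω p f).toReal :=
  integral_eq_lintegral_of_nonneg_ae (Eventually.of_forall fun x => by positivity)
    (aemeasurable_norm_rpow hpm hf.1).aestronglyMeasurable

lemma memVarLp_of_bounded (hp : ∀ᵐ x ∂μ.restrict Ω, 1 ≤ p x ∧ p x ≤ pp) {f : M → F}
    (hf : AEStronglyMeasurable f (μ.restrict Ω)) {K : Set M} (hK : MeasurableSet K)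
    (hKμ : μ K < ⊤) {B : ℝ} (hB : ∀ᵐ x ∂μ.restrict Ω, ‖f x‖ ≤ K.indicator (fun _ => B) x) :
    MemVarLp μ Ω p f := by
  refine ⟨hf, lt_of_le_of_lt (b := ∫⁻ x in Ω, K.indicator
    (fun _ => ENNReal.ofReal ((max B 1) ^ pp)) x ∂μ) (lintegral_mono_ae ?_) ?_⟩
  · filter_upwards [hp, hB] with x hx hb
    by_cases hxK : x ∈ K
    · simp only [Set.indicator_of_mem hxK] at hb ⊢
      refine ENNReal.ofReal_le_ofReal ?_
      exact (Real.rpow_le_rpow (norm_nonneg _) (hb.trans (le_max_left _ 1)) (by linarith)).trans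
        (Real.rpow_le_rpow_of_exponent_le (le_max_right _ _) hx.2)
    · simp only [Set.indicator_of_notMem hxK] at hb ⊢
      have h0 : ‖f x‖ = 0 := le_antisymm hb (norm_nonneg _)
      rw [h0, Real.zero_rpow (by linarith)]
      simp
  · rw [lintegral_indicator hK, lintegral_const]
    refine ENNReal.mul_lt_top ENNReal.ofReal_lt_top ?_
    rw [Measure.restrict_apply_univ]
    exact (Measure.restrict_apply_le _ _).trans_lt hKμ

lemma luxNorm_nonneg [NormedSpace ℝ F] (f : M → F) : 0 ≤ luxNorm μ Ω p f :=
  Real.sInf_nonneg fun _ ht => ht.1.le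

lemma luxNorm_le [NormedSpace ℝ F] {f : M → F} {t : ℝ} (ht : 0 < t)
    (h : modular μ Ω p (fun x => t⁻¹ • f x) ≤ 1) : luxNorm μ Ω p f ≤ t :=
  csInf_le ⟨0, fun _ hs => hs.1.le⟩ ⟨ht, h⟩

lemma tendsto_luxNorm_of_modular [NormedSpace ℝ F]
    (hp : ∀ᵐ x ∂μ.restrict Ω, 1 ≤ p x ∧ p x ≤ pp)
    {f : ℕ → M → F} (h : Tendsto (fun i => modular μ Ω p (f i)) atTop (𝓝 0)) :
    Tendsto (fun i => luxNorm μ Ω p (f i)) atTop (𝓝 0) := by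
  have key : ∀ t : ℝ, 0 < t → t < 1 → ∀ᶠ i in atTop, luxNorm μ Ω p (f i) ≤ t := by
    intro t ht ht1
    have hc : 0 < t⁻¹ ^ pp := by positivity
    have h2 : Tendsto (fun i => ENNReal.ofReal (t⁻¹ ^ pp) * modular μ Ω p (f i)) atTop (𝓝 0) := by
      simpa using ENNReal.Tendsto.const_mul h (Or.inr ENNReal.ofReal_ne_top)
    filter_upwards [h2.eventually (ge_mem_nhds zero_lt_one)] with i hi
    refine luxNorm_le ht ((modular_smul_le ?_ hc.le _).trans hi)
    filter_upwards [hp] with x hx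
    rw [abs_of_pos (inv_pos.2 ht)]
    exact Real.rpow_le_rpow_of_exponent_le ((one_le_inv₀ ht).2 ht1.le) hx.2
  rw [Metric.tendsto_atTop']
  intro ε hε
  obtain ⟨N, hN⟩ := eventually_atTop.1
    (key (min (ε / 2) (1 / 2)) (by positivity) (by norm_num))
  refine ⟨N, fun i hi => ?_⟩
  rw [Real.dist_0_eq_abs, abs_of_nonneg (luxNorm_nonneg _)]
  exact (hN i hi.le).trans_lt ((min_le_left _ _).trans_lt (by linarith))

/-- The modular is controlled by the Luxemburg norm once the latter is less than `1`. Finiteness of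
the modular is needed since `luxNorm` of a function outside `L^{p(·)}` is the junk value `0`. -/
lemma modular_le_of_luxNorm_lt [NormedSpace ℝ F] (hp : ∀ᵐ x ∂μ.restrict Ω, 1 ≤ p x ∧ p x ≤ pp)
    {f : M → F} (hf : modular μ Ω p f < ⊤) {t : ℝ} (ht1 : t ≤ 1) (h : luxNorm μ Ω p f < t) :
    modular μ Ω p f ≤ ENNReal.ofReal t := by
  have hne : {t : ℝ | 0 < t ∧ modular μ Ω p (fun x => t⁻¹ • f x) ≤ 1}.Nonempty := by
    set m := (modular μ Ω p f).toReal
    have hm : 0 ≤ m := ENNReal.toReal_nonneg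
    refine ⟨m + 1, by positivity, ?_⟩
    refine (modular_smul_le (D := (m + 1)⁻¹) ?_ (by positivity) f).trans ?_
    · filter_upwards [hp] with x hx
      rw [abs_of_pos (by positivity)]
      calc ((m + 1)⁻¹ : ℝ) ^ p x ≤ (m + 1)⁻¹ ^ (1 : ℝ) :=
            Real.rpow_le_rpow_of_exponent_ge (by positivity)
              (inv_le_one_of_one_le₀ (by linarith)) hx.1
        _ = _ := Real.rpow_one _
    · rw [← ENNReal.ofReal_toReal hf.ne, ← ENNReal.ofReal_mul (by positivity)]
      refine ENNReal.ofReal_le_one.2 ?_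
      rw [inv_mul_le_iff₀ (by positivity)]
      change m ≤ _
      linarith
  obtain ⟨s, ⟨hs, hs1⟩, hst⟩ := exists_lt_of_csInf_lt hne h
  have h2 : modular μ Ω p (fun x => s • s⁻¹ • f x) ≤ ENNReal.ofReal s * 1 := by
    refine (modular_smul_le (D := s) ?_ hs.le _).trans (by gcongr)
    filter_upwards [hp] with x hx
    rw [abs_of_pos hs]
    calc s ^ p x ≤ s ^ (1 : ℝ) :=
          Real.rpow_le_rpow_of_exponent_ge hs (hst.le.trans ht1) hx.1
      _ = _ := Real.rpow_one _
  simp only [smul_inv_smul₀ hs.ne', mul_one] at h2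
  exact h2.trans (ENNReal.ofReal_le_ofReal hst.le)

lemma tendsto_modular_of_luxNorm [NormedSpace ℝ F] (hp : ∀ᵐ x ∂μ.restrict Ω, 1 ≤ p x ∧ p x ≤ pp)
    {f : ℕ → M → F} (hf : ∀ i, modular μ Ω p (f i) < ⊤)
    (h : Tendsto (fun i => luxNorm μ Ω p (f i)) atTop (𝓝 0)) :
    Tendsto (fun i => modular μ Ω p (f i)) atTop (𝓝 0) := by
  rw [ENNReal.tendsto_nhds_zero]
  intro ε hε
  obtain ⟨t, ht, htε⟩ : ∃ t : ℝ, (0 < t ∧ t ≤ 1) ∧ ENNReal.ofReal t ≤ ε := by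
    refine ⟨(min ε 1).toReal, ⟨ENNReal.toReal_pos (by simp [hε.ne']) (by simp), ?_⟩, ?_⟩
    · exact ENNReal.toReal_le_of_le_ofReal zero_le_one (by simp)
    · rw [ENNReal.ofReal_toReal (by simp)]
      exact min_le_left _ _
  filter_upwards [h.eventually (gt_mem_nhds ht.1)] with i hi
  exact (modular_le_of_luxNorm_lt hp (hf i) ht.2 hi).trans htε

/-- Pointwise form of the embedding of `L^{p(·)}` into `L¹` on sets of finite measure. -/
lemma le_add_rpow {a δ q Q : ℝ} (ha : 0 ≤ a) (hδ : 0 < δ) (hδ1 : δ ≤ 1) (hq : 1 ≤ q)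
    (hQ : q ≤ Q) : a ≤ δ + δ ^ (1 - Q) * a ^ q := by
  rcases le_total a δ with h | h
  · exact h.trans (le_add_of_nonneg_right (by positivity))
  · have ha' : 0 < a := hδ.trans_le h
    have h1 : a = a ^ (1 - q) * a ^ q := by
      rw [← Real.rpow_add ha', sub_add_cancel, Real.rpow_one]
    have h2 : a ^ (1 - q) ≤ δ ^ (1 - Q) :=
      (Real.rpow_le_rpow_of_nonpos hδ h (by linarith)).trans
        (Real.rpow_le_rpow_of_exponent_ge hδ hδ1 (by linarith))
    calc a = a ^ (1 - q) * a ^ q := h1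
      _ ≤ δ ^ (1 - Q) * a ^ q := by gcongr
      _ ≤ _ := le_add_of_nonneg_left hδ.le

lemma lintegral_mul_le_modular (hp : ∀ᵐ x ∂μ.restrict Ω, 1 ≤ p x ∧ p x ≤ pp)
    (f : M → ℝ) {ψ : M → ℝ} {K : Set M} (hK : MeasurableSet K) {B : ℝ} (hB0 : 0 ≤ B)
    (hB : ∀ x, |ψ x| ≤ K.indicator (fun _ => B) x) {δ : ℝ} (hδ : 0 < δ) (hδ1 : δ ≤ 1) :
    ∫⁻ x in Ω, ‖f x * ψ x‖ₑ ∂μ ≤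
      ENNReal.ofReal (B * δ) * μ K + ENNReal.ofReal (B * δ ^ (1 - pp)) * modular μ Ω p f := by
  calc ∫⁻ x in Ω, ‖f x * ψ x‖ₑ ∂μ
      ≤ ∫⁻ x in Ω, (K.indicator (fun _ => ENNReal.ofReal (B * δ)) x +
          ENNReal.ofReal (B * δ ^ (1 - pp)) * ENNReal.ofReal (‖f x‖ ^ p x)) ∂μ := by
        refine lintegral_mono_ae ?_
        filter_upwards [hp] with x hx
        have hb := hB x
        by_cases hxK : x ∈ K
        · simp only [Set.indicator_of_mem hxK] at hb ⊢
          rw [← ENNReal.ofReal_mul (by positivity), ← ENNReal.ofReal_add (by positivity)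
            (by positivity), Real.enorm_eq_ofReal_abs]
          refine ENNReal.ofReal_le_ofReal ?_
          rw [abs_mul]
          calc |f x| * |ψ x| ≤ (δ + δ ^ (1 - pp) * ‖f x‖ ^ p x) * B := by
                gcongr
                exact le_add_rpow (norm_nonneg (f x)) hδ hδ1 hx.1 hx.2
            _ = _ := by ring
        · simp only [Set.indicator_of_notMem hxK] at hb ⊢
          rw [abs_nonpos_iff.1 hb]
          simp
    _ = ENNReal.ofReal (B * δ) * μ.restrict Ω K +
          ENNReal.ofReal (B * δ ^ (1 - pp)) * modular μ Ω p f := by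
        rw [lintegral_add_left (measurable_const.indicator hK),
          lintegral_const_mul' _ _ ENNReal.ofReal_ne_top, lintegral_indicator_const hK]
        rfl
    _ ≤ _ := add_le_add (mul_le_mul_right (Measure.restrict_apply_le _ _) _) le_rfl

lemma integrable_mul_of_memVarLp (hp : ∀ᵐ x ∂μ.restrict Ω, 1 ≤ p x ∧ p x ≤ pp)
    {f : M → ℝ} (hf : MemVarLp μ Ω p f) {ψ : M → ℝ}
    (hψ : AEStronglyMeasurable ψ (μ.restrict Ω)) {K : Set M} (hK : MeasurableSet K)
    (hKμ : μ K < ⊤) {B : ℝ} (hB0 : 0 ≤ B) (hB : ∀ x, |ψ x| ≤ K.indicator (fun _ => B) x) :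
    Integrable (fun x => f x * ψ x) (μ.restrict Ω) := by
  refine ⟨hf.1.mul hψ, ?_⟩
  refine (lintegral_mul_le_modular hp f hK hB0 hB one_pos le_rfl).trans_lt ?_
  exact ENNReal.add_lt_top.2 ⟨ENNReal.mul_lt_top ENNReal.ofReal_lt_top hKμ,
    ENNReal.mul_lt_top ENNReal.ofReal_lt_top hf.2⟩

/-- Convergence in modular implies weak convergence against bounded functions vanishing off a set of
finite measure. -/
lemma tendsto_integral_mul_of_modular (hp : ∀ᵐ x ∂μ.restrict Ω, 1 ≤ p x ∧ p x ≤ pp)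
    {f : ℕ → M → ℝ} (h : Tendsto (fun i => modular μ Ω p (f i)) atTop (𝓝 0)) {ψ : M → ℝ}
    {K : Set M} (hK : MeasurableSet K) (hKμ : μ K < ⊤) {B : ℝ} (hB0 : 0 ≤ B)
    (hB : ∀ x, |ψ x| ≤ K.indicator (fun _ => B) x) :
    Tendsto (fun i => ∫ x in Ω, f i x * ψ x ∂μ) atTop (𝓝 0) := by
  rw [tendsto_zero_iff_enorm_tendsto_zero, ENNReal.tendsto_nhds_zero]
  intro ε hε
  -- first make the contribution of `K` small by the choice of `δ`, then let `i → ∞`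
  have h1 : Tendsto (fun δ : ℝ => ENNReal.ofReal (B * δ) * μ K) (𝓝[>] 0) (𝓝 0) := by
    have : Tendsto (fun δ : ℝ => ENNReal.ofReal (B * δ)) (𝓝[>] 0) (𝓝 0) := by
      have h0 : Tendsto (fun δ : ℝ => B * δ) (𝓝[>] 0) (𝓝 0) := by
        have : Tendsto (fun δ : ℝ => B * δ) (𝓝 0) (𝓝 (B * 0)) := (continuous_const_mul B).tendsto 0
        rw [mul_zero] at this
        exact this.mono_left nhdsWithin_le_nhds
      simpa using ENNReal.tendsto_ofReal h0
    simpa using ENNReal.Tendsto.mul_const this (Or.inr hKμ.ne)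
  have hε2 : 0 < ε / 2 := ENNReal.half_pos hε.ne'
  obtain ⟨δ, ⟨hδK, hδ1⟩, hδ⟩ := ((h1.eventually (ge_mem_nhds hε2)).and
    ((Ioc_mem_nhdsGT (zero_lt_one' ℝ)))).exists.imp fun δ h => (⟨⟨h.1, h.2.2⟩, h.2.1⟩ : (_ ∧ _) ∧ _)
  have h2 : Tendsto (fun i => ENNReal.ofReal (B * δ ^ (1 - pp)) * modular μ Ω p (f i)) atTop
      (𝓝 0) := by
    simpa using ENNReal.Tendsto.const_mul h (Or.inr ENNReal.ofReal_ne_top)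
  filter_upwards [h2.eventually (ge_mem_nhds hε2)] with i hi
  calc ‖∫ x in Ω, f i x * ψ x ∂μ‖ₑ ≤ ∫⁻ x in Ω, ‖f i x * ψ x‖ₑ ∂μ :=
        enorm_integral_le_lintegral_enorm _
    _ ≤ _ := lintegral_mul_le_modular hp (f i) hK hB0 hB hδ hδ1
    _ ≤ ε / 2 + ε / 2 := add_le_add hδK hi
    _ = ε := ENNReal.add_halves ε

/-- The modular of `f` is the `L¹` norm of `‖f‖ ^ p`, so convergence in modular entails convergence
in measure of `‖f‖ ^ p`. -/
lemma exists_subseq_tendsto_ae_of_modular (hp : ∀ᵐ x ∂μ.restrict Ω, 1 ≤ p x ∧ p x ≤ pp)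
    (hpm : AEMeasurable p (μ.restrict Ω)) {f : ℕ → M → F}
    (hf : ∀ i, AEStronglyMeasurable (f i) (μ.restrict Ω))
    (h : Tendsto (fun i => modular μ Ω p (f i)) atTop (𝓝 0)) :
    ∃ ns : ℕ → ℕ, StrictMono ns ∧
      ∀ᵐ x ∂μ.restrict Ω, Tendsto (fun i => f (ns i) x) atTop (𝓝 0) := by
  have h1 : TendstoInMeasure (μ.restrict Ω) (fun i x => ‖f i x‖ ^ p x) atTop (fun _ => 0) := by
    refine tendstoInMeasure_of_tendsto_eLpNorm (p := 1) one_ne_zero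
      (fun i => (aemeasurable_norm_rpow hpm (hf i)).aestronglyMeasurable)
      aestronglyMeasurable_const ?_
    refine h.congr fun i => ?_
    rw [eLpNorm_one_eq_lintegral_enorm]
    refine lintegral_congr fun x => ?_
    simp only [Pi.sub_apply, sub_zero]
    rw [Real.enorm_of_nonneg (by positivity)]
  obtain ⟨ns, hns, hae⟩ := h1.exists_seq_tendsto_ae
  refine ⟨ns, hns, ?_⟩
  filter_upwards [hae, hp] with x hx hpx
  have hpos : 0 < p x := by linarith
  rw [tendsto_zero_iff_norm_tendsto_zero]
  have h2 := hx.rpow_const (p := (p x)⁻¹) (Or.inr (inv_pos.2 hpos).le)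
  rw [Real.zero_rpow (inv_pos.2 hpos).ne'] at h2
  refine h2.congr fun i => ?_
  rw [← Real.rpow_mul (norm_nonneg _), mul_inv_cancel₀ hpos.ne', Real.rpow_one]

lemma tendsto_modular_of_dominated (hp : ∀ᵐ x ∂μ.restrict Ω, 1 ≤ p x ∧ p x ≤ pp)
    (hpm : AEMeasurable p (μ.restrict Ω)) {f : ℕ → M → F}
    (hf : ∀ i, AEStronglyMeasurable (f i) (μ.restrict Ω)) {H : M → ℝ} (hH : MemVarLp μ Ω p H)
    (hfH : ∀ i, ∀ᵐ x ∂μ.restrict Ω, ‖f i x‖ ≤ H x)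
    (hlim : ∀ᵐ x ∂μ.restrict Ω, Tendsto (fun i => f i x) atTop (𝓝 0)) :
    Tendsto (fun i => modular μ Ω p (f i)) atTop (𝓝 0) := by
  have := tendsto_lintegral_of_dominated_convergence'
    (μ := μ.restrict Ω) (F := fun i x => ENNReal.ofReal (‖f i x‖ ^ p x)) (f := fun _ => 0)
    (fun x => ENNReal.ofReal (‖H x‖ ^ p x))
    (fun i => (aemeasurable_norm_rpow hpm (hf i)).ennreal_ofReal)
    (fun i => by
      filter_upwards [hfH i, hp] with x hx hpx
      exact ENNReal.ofReal_le_ofReal (Real.rpow_le_rpow (norm_nonneg _)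
        (hx.trans (le_abs_self _)) (by linarith)))
    hH.2.ne
    (by
      filter_upwards [hlim, hp] with x hx hpx
      have h1 := hx.norm.rpow_const (p := p x) (Or.inr (by linarith))
      rw [norm_zero, Real.zero_rpow (by linarith)] at h1
      simpa using ENNReal.tendsto_ofReal h1)
  simpa [modular] using this

end Modular

/-! ### Horizontal gradients of classical functions -/

section Geometry

variable {n N : ℕ} {M : Type*} [TopologicalSpace M]
  [ChartedSpace (EuclideanSpace ℝ (Fin n)) M]

/-- The derivative of a `C¹` function along a smooth vector field is continuous. -/
lemma continuousOn_mfderiv_apply [IsManifold (𝓡 n) ∞ M]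
    {X : Fin N → (x : M) → TangentSpace (𝓡 n) x} (hX : SmoothFields X) (k : Fin N)
    {F : Type*} [NormedAddCommGroup F] [NormedSpace ℝ F] {f : M → F} {U : Set M} (hU : IsOpen U)
    (hf : ContMDiffOn (𝓡 n) 𝓘(ℝ, F) 1 f U) :
    ContinuousOn (fun x => (mfderiv (𝓡 n) 𝓘(ℝ, F) f x (X k x) : F)) U := by
  have : IsManifold (𝓡 n) 1 M := IsManifold.of_le (n := ∞) (by simp)
  have h1 := hf.continuousOn_tangentMapWithin le_rfl hU.uniqueMDiffOn
  have h2 : ContinuousOn (fun x => (⟨x, X k x⟩ : TangentBundle (𝓡 n) M)) U :=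
    (hX k).continuous.continuousOn
  have h3 := h1.comp h2 (fun x hx => hx)
  have h4 := ((tangentBundleModelSpaceHomeomorph 𝓘(ℝ, F)).continuous.comp_continuousOn h3).snd
  refine h4.congr fun x hx => ?_
  simp only [Function.comp, tangentMapWithin, mfderivWithin_of_isOpen hU hx]
  rfl

lemma continuousOn_hGrad [IsManifold (𝓡 n) ∞ M]
    {X : Fin N → (x : M) → TangentSpace (𝓡 n) x} (hX : SmoothFields X)
    {f : M → ℝ} {U : Set M} (hU : IsOpen U) (hf : ContMDiffOn (𝓡 n) 𝓘(ℝ, ℝ) 1 f U) :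
    ContinuousOn (hGrad X f) U :=
  (PiLp.continuous_toLp 2 _).comp_continuousOn
    (continuousOn_pi.2 fun k => continuousOn_mfderiv_apply hX k hU hf)

lemma hGrad_congr {X : Fin N → (x : M) → TangentSpace (𝓡 n) x} {f g : M → ℝ} {x : M}
    (h : f =ᶠ[𝓝 x] g) : hGrad X f x = hGrad X g x := by
  unfold hGrad
  rw [h.mfderiv_eq]
  rfl

/-- The horizontal gradient in terms of the Fréchet derivative in the chart centred at the point. -/
lemma hGrad_apply_of_hasFDerivAt {X : Fin N → (x : M) → TangentSpace (𝓡 n) x} {f : M → ℝ} {x : M}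
    (hf : ContinuousAt f x) {L : EuclideanSpace ℝ (Fin n) →L[ℝ] ℝ}
    (h : HasFDerivAt (f ∘ (extChartAt (𝓡 n) x).symm) L (extChartAt (𝓡 n) x x)) (k : Fin N) :
    hGrad X f x k = L (X k x) := by
  have h1 : HasMFDerivAt (𝓡 n) 𝓘(ℝ, ℝ) f x L := ⟨hf, h.hasFDerivWithinAt⟩
  simp only [hGrad, h1.mfderiv]
  rfl

lemma hasFDerivAt_chart {f : M → ℝ} {x : M} (hf : MDifferentiableAt (𝓡 n) 𝓘(ℝ, ℝ) f x) :
    ∃ L : EuclideanSpace ℝ (Fin n) →L[ℝ] ℝ,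
      HasFDerivAt (f ∘ (extChartAt (𝓡 n) x).symm) L (extChartAt (𝓡 n) x x) := by
  have h := hf.hasMFDerivAt.2
  simp only [modelWithCornersSelf_coe, Set.range_id] at h
  exact ⟨mfderiv (𝓡 n) 𝓘(ℝ, ℝ) f x, HasFDerivWithinAt.hasFDerivAt (s := Set.univ) h univ_mem⟩

lemma hGrad_const {X : Fin N → (x : M) → TangentSpace (𝓡 n) x} (c : ℝ) (x : M) :
    hGrad X (fun _ => c) x = 0 := by
  ext k
  simp only [hGrad, mfderiv_const]
  rfl

lemma hGrad_of_notMem_tsupport {X : Fin N → (x : M) → TangentSpace (𝓡 n) x} {f : M → ℝ} {x : M}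
    (h : x ∉ tsupport f) : hGrad X f x = 0 := by
  rw [hGrad_congr (notMem_tsupport_iff_eventuallyEq.1 h)]
  exact hGrad_const 0 x

lemma hGrad_add {X : Fin N → (x : M) → TangentSpace (𝓡 n) x} {f g : M → ℝ} {x : M}
    (hf : MDifferentiableAt (𝓡 n) 𝓘(ℝ, ℝ) f x) (hg : MDifferentiableAt (𝓡 n) 𝓘(ℝ, ℝ) g x) :
    hGrad X (fun x => f x + g x) x = hGrad X f x + hGrad X g x := by
  ext k
  obtain ⟨Lf, hLf⟩ := hasFDerivAt_chart hf
  obtain ⟨Lg, hLg⟩ := hasFDerivAt_chart hg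
  refine (hGrad_apply_of_hasFDerivAt (hf.continuousAt.add hg.continuousAt)
    (hLf.add hLg) k).trans ?_
  rw [PiLp.add_apply, hGrad_apply_of_hasFDerivAt hf.continuousAt hLf,
    hGrad_apply_of_hasFDerivAt hg.continuousAt hLg]
  rfl

lemma IsTest.mdifferentiableAt [IsManifold (𝓡 n) ∞ M] {Ω : Set M} {φ : M → ℝ} (h : IsTest n Ω φ)
    (x : M) : MDifferentiableAt (𝓡 n) 𝓘(ℝ, ℝ) φ x :=
  h.1.mdifferentiableAt (by simp)

lemma IsTest.contMDiff_one {Ω : Set M} {φ : M → ℝ} (h : IsTest n Ω φ) :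
    ContMDiff (𝓡 n) 𝓘(ℝ, ℝ) 1 φ := h.1.of_le (by simp)

lemma IsTest.add {Ω : Set M} {φ ψ : M → ℝ} (hφ : IsTest n Ω φ) (hψ : IsTest n Ω ψ) :
    IsTest n Ω (fun x => φ x + ψ x) :=
  ⟨hφ.1.add hψ.1, hφ.2.1.add hψ.2.1,
    (tsupport_add φ ψ).trans (Set.union_subset hφ.2.2 hψ.2.2)⟩

lemma IsTest.zero {Ω : Set M} : IsTest n Ω (fun _ : M => (0 : ℝ)) := by
  refine ⟨contMDiff_const, HasCompactSupport.zero, ?_⟩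
  have : tsupport (fun _ : M => (0 : ℝ)) = ∅ := tsupport_eq_empty_iff.2 rfl
  rw [this]; exact Set.empty_subset _

/-- A smooth volume is finite on compact sets. -/
lemma IsSmoothVolume.isLocallyFiniteMeasure [T2Space M] [MeasurableSpace M] [BorelSpace M]
    {μ : Measure M} (hμ : IsSmoothVolume n μ) : IsLocallyFiniteMeasure μ := by
  have : LocallyCompactSpace M := ChartedSpace.locallyCompactSpace (EuclideanSpace ℝ (Fin n)) M
  refine ⟨fun x => ?_⟩
  obtain ⟨K, hKx, hKs, hK⟩ := LocallyCompactSpace.local_compact_nhds x _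
    (chart_source_mem_nhds (EuclideanSpace ℝ (Fin n)) x)
  refine ⟨K, hKx, ?_⟩
  obtain ⟨ρ, hρ, -, hμρ⟩ := hμ _ (chart_mem_atlas (EuclideanSpace ℝ (Fin n)) x)
  rw [hμρ K hKs hK.measurableSet]
  have hKe : IsCompact (chartAt (EuclideanSpace ℝ (Fin n)) x '' K) :=
    hK.image_of_continuousOn ((chartAt _ x).continuousOn.mono hKs)
  have hsub : chartAt (EuclideanSpace ℝ (Fin n)) x '' K ⊆ (chartAt _ x).target :=
    Set.image_subset_iff.2 fun y hy => (chartAt _ x).map_source (hKs hy)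
  obtain ⟨C, hC⟩ := hKe.exists_bound_of_continuousOn (hρ.continuousOn.mono hsub)
  refine (setLIntegral_mono' (g := fun _ => ENNReal.ofReal C) hKe.measurableSet
    fun y hy => ENNReal.ofReal_le_ofReal ((le_abs_self _).trans (hC y hy))).trans_lt ?_
  rw [setLIntegral_const]
  exact ENNReal.mul_lt_top ENNReal.ofReal_lt_top hKe.measure_lt_top

/-- A smooth volume charges every nonempty open set. -/
lemma IsSmoothVolume.measure_pos [MeasurableSpace M] [BorelSpace M]
    {μ : Measure M} (hμ : IsSmoothVolume n μ) {Ω : Set M} (hΩ : IsOpen Ω) (hne : Ω.Nonempty) :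
    0 < μ Ω := by
  obtain ⟨x, hx⟩ := hne
  set e := chartAt (EuclideanSpace ℝ (Fin n)) x
  obtain ⟨ρ, hρ, hpos, hμρ⟩ := hμ _ (chart_mem_atlas (EuclideanSpace ℝ (Fin n)) x)
  have hU : IsOpen (Ω ∩ e.source) := hΩ.inter e.open_source
  have heU : IsOpen (e '' (Ω ∩ e.source)) :=
    e.isOpen_image_of_subset_source hU Set.inter_subset_right
  have hsub : e '' (Ω ∩ e.source) ⊆ e.target :=
    Set.image_subset_iff.2 fun y hy => e.map_source hy.2
  refine lt_of_lt_of_le ?_ (measure_mono (Set.inter_subset_left (t := e.source)))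
  rw [hμρ _ Set.inter_subset_right hU.measurableSet]
  have hm : AEMeasurable (fun y => ENNReal.ofReal (ρ y))
      (volume.restrict (e '' (Ω ∩ e.source))) :=
    ((hρ.continuousOn.mono hsub).aemeasurable heU.measurableSet).ennreal_ofReal
  rw [pos_iff_ne_zero, Ne, lintegral_eq_zero_iff' hm]
  intro h0
  have h1 : volume (e '' (Ω ∩ e.source)) = 0 := by
    rw [← Measure.restrict_eq_zero, ← ae_eq_bot, ← Filter.eventually_false_iff_eq_bot]
    filter_upwards [h0, ae_restrict_mem heU.measurableSet] with y hy hy'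
    have := hpos y (hsub hy')
    simp only [Pi.zero_apply, ENNReal.ofReal_eq_zero] at hy
    linarith
  exact (heU.measure_pos volume ⟨e x, x, ⟨hx, mem_chart_source _ x⟩, rfl⟩).ne' h1

end Geometry

/-! ### Smooth approximation of compactly supported `C¹` functions -/

section Approximation

/-- Mollification: a compactly supported `C¹` function on a Euclidean space is a `C¹`-limit of
smooth functions with support in a fixed compact subset of any given neighbourhood of its
support. -/
lemma exists_contDiff_approx_fderiv {E : Type*} [NormedAddCommGroup E] [NormedSpace ℝ E]
    [FiniteDimensional ℝ E] {f : E → ℝ} (hf : ContDiff ℝ 1 f)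
    (hfc : HasCompactSupport f) {U : Set E} (hU : IsOpen U) (hfU : tsupport f ⊆ U) :
    ∃ K : Set E, IsCompact K ∧ K ⊆ U ∧ tsupport f ⊆ K ∧ ∀ ε > 0, ∃ F : E → ℝ, ContDiff ℝ ∞ F ∧
      tsupport F ⊆ K ∧ ∀ y, |f y - F y| ≤ ε ∧ ‖fderiv ℝ f y - fderiv ℝ F y‖ ≤ ε := by
  borelize E
  obtain ⟨r, hr, hrU⟩ := IsCompact.exists_cthickening_subset_open hfc.isCompact hU hfU
  refine ⟨Metric.cthickening r (tsupport f), hfc.isCompact.cthickening, hrU,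
    Metric.self_subset_cthickening _, fun ε hε => ?_⟩
  have hu1 : UniformContinuous f := hfc.uniformContinuous_of_continuous hf.continuous
  have hc2 : Continuous (fderiv ℝ f) := hf.continuous_fderiv one_ne_zero
  have hu2 : UniformContinuous (fderiv ℝ f) :=
    (hfc.fderiv ℝ).uniformContinuous_of_continuous hc2
  obtain ⟨δ₁, hδ₁, h1⟩ := Metric.uniformContinuous_iff.1 hu1 ε hε
  obtain ⟨δ₂, hδ₂, h2⟩ := Metric.uniformContinuous_iff.1 hu2 ε hε
  set δ := min r (min δ₁ δ₂)
  have hδ : 0 < δ := by positivity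
  let b : ContDiffBump (0 : E) := ⟨δ / 2, δ, half_pos hδ, half_lt_self hδ⟩
  let μ : Measure E := Measure.addHaar
  let L := ContinuousLinearMap.lsmul ℝ ℝ (E := ℝ)
  have hb : LocallyIntegrable (b.normed μ) μ := b.continuous_normed.locallyIntegrable
  have hderiv : ∀ y, fderiv ℝ (convolution (b.normed μ) f L μ) y =
      convolution (b.normed μ) (fderiv ℝ f) (ContinuousLinearMap.lsmul ℝ ℝ) μ y := by
    intro y
    rw [(hfc.hasFDerivAt_convolution_right L hb hf y).fderiv]
    unfold convolution
    congr 1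
  refine ⟨convolution (b.normed μ) f L μ,
    b.hasCompactSupport_normed.contDiff_convolution_left _ b.contDiff_normed
      hf.continuous.locallyIntegrable, ?_, fun y => ⟨?_, ?_⟩⟩
  · refine closure_minimal ?_ Metric.isClosed_cthickening
    refine (support_convolution_subset L).trans ?_
    rintro _ ⟨u, hu, z, hz, rfl⟩
    rw [b.support_normed_eq] at hu
    refine Metric.mem_cthickening_of_dist_le _ z _ _ (subset_tsupport f hz) ?_
    have : ‖u‖ < δ := by simpa using hu
    simp only [dist_eq_norm, add_sub_cancel_right]
    exact this.le.trans (min_le_left _ _)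
  · rw [abs_sub_comm, ← Real.dist_eq]
    refine b.dist_normed_convolution_le hf.continuous.aestronglyMeasurable fun x hx => ?_
    exact (h1 ((Metric.mem_ball.1 hx).trans_le
      ((min_le_right _ _).trans (min_le_left _ _)))).le
  · rw [hderiv, norm_sub_rev, ← dist_eq_norm]
    refine b.dist_normed_convolution_le hc2.aestronglyMeasurable fun x hx => ?_
    exact (h2 ((Metric.mem_ball.1 hx).trans_le
      ((min_le_right _ _).trans (min_le_right _ _)))).le

variable {n N : ℕ} {M : Type*} [TopologicalSpace M]
  [ChartedSpace (EuclideanSpace ℝ (Fin n)) M]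

/-- `f` is a limit, uniformly together with its horizontal gradient, of test functions supported in
a fixed compact subset of `Ω`. -/
def IsTestLimit (X : Fin N → (x : M) → TangentSpace (𝓡 n) x) (Ω : Set M) (f : M → ℝ) : Prop :=
  ∃ K : Set M, IsCompact K ∧ K ⊆ Ω ∧ tsupport f ⊆ K ∧ ∀ ε > 0, ∃ F : M → ℝ, IsTest n Ω F ∧
    tsupport F ⊆ K ∧ ∀ x, |f x - F x| ≤ ε ∧ ‖hGrad X f x - hGrad X F x‖ ≤ ε

lemma isTestLimit_zero {X : Fin N → (x : M) → TangentSpace (𝓡 n) x} {Ω : Set M} :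
    IsTestLimit X Ω (fun _ => (0 : ℝ)) := by
  have h0 : tsupport (fun _ : M => (0 : ℝ)) = ∅ := tsupport_eq_empty_iff.2 rfl
  refine ⟨∅, isCompact_empty, Set.empty_subset _, by rw [h0], fun ε hε =>
    ⟨fun _ => 0, IsTest.zero, by rw [h0], fun x => ?_⟩⟩
  simp [hε.le]

lemma IsTestLimit.add [IsManifold (𝓡 n) ∞ M] {X : Fin N → (x : M) → TangentSpace (𝓡 n) x}
    {Ω : Set M} {f g : M → ℝ}
    (hf1 : ContMDiff (𝓡 n) 𝓘(ℝ, ℝ) 1 f) (hg1 : ContMDiff (𝓡 n) 𝓘(ℝ, ℝ) 1 g)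
    (hf : IsTestLimit X Ω f) (hg : IsTestLimit X Ω g) :
    IsTestLimit X Ω (fun x => f x + g x) := by
  obtain ⟨K, hK, hKΩ, hfK, hF⟩ := hf
  obtain ⟨K', hK', hKΩ', hgK, hG⟩ := hg
  refine ⟨K ∪ K', hK.union hK', Set.union_subset hKΩ hKΩ',
    (tsupport_add f g).trans (Set.union_subset_union hfK hgK), fun ε hε => ?_⟩
  obtain ⟨F, hFt, hFK, hFe⟩ := hF (ε / 2) (half_pos hε)
  obtain ⟨G, hGt, hGK, hGe⟩ := hG (ε / 2) (half_pos hε)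
  refine ⟨fun x => F x + G x, hFt.add hGt,
    (tsupport_add F G).trans (Set.union_subset_union hFK hGK), fun x => ⟨?_, ?_⟩⟩
  · rw [add_sub_add_comm]
    exact (abs_add_le _ _).trans ((add_le_add (hFe x).1 (hGe x).1).trans (add_halves ε).le)
  · rw [hGrad_add (hf1.mdifferentiableAt one_ne_zero) (hg1.mdifferentiableAt one_ne_zero),
      hGrad_add (IsTest.mdifferentiableAt hFt x) (IsTest.mdifferentiableAt hGt x), add_sub_add_comm]
    exact (norm_add_le _ _).trans ((add_le_add (hFe x).2 (hGe x).2).trans (add_halves ε).le)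

lemma contMDiff_of_isOpen_tsupport {f : M → ℝ} {U : Set M} (hU : IsOpen U)
    (hf : ContMDiffOn (𝓡 n) 𝓘(ℝ, ℝ) 1 f U) (h : tsupport f ⊆ U) :
    ContMDiff (𝓡 n) 𝓘(ℝ, ℝ) 1 f :=
  contMDiff_of_tsupport fun x hx => (hf x (h hx)).contMDiffAt (hU.mem_nhds (h hx))

/-- The case of a function supported in one chart domain. Only finitely many continuous functions
`d e (X k)` intervene in the chain rule, and they are bounded on the compact set `K`. -/
lemma isTestLimit_of_chart [T2Space M] [IsManifold (𝓡 n) ∞ M]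
    {X : Fin N → (x : M) → TangentSpace (𝓡 n) x} (hX : SmoothFields X) {Ω : Set M}
    (hΩ : IsOpen Ω) {f : M → ℝ} (hf : ContMDiff (𝓡 n) 𝓘(ℝ, ℝ) 1 f)
    (hfc : HasCompactSupport f) (c : M)
    (hfU : tsupport f ⊆ Ω ∩ (chartAt (EuclideanSpace ℝ (Fin n)) c).source) :
    IsTestLimit X Ω f := by
  have : IsManifold (𝓡 n) 1 M := IsManifold.of_le (n := ∞) (by simp)
  set e := chartAt (EuclideanSpace ℝ (Fin n)) c with he
  have heA : e ∈ IsManifold.maximalAtlas (𝓡 n) ∞ M := IsManifold.chart_mem_maximalAtlas c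
  have heA1 : e ∈ IsManifold.maximalAtlas (𝓡 n) 1 M := IsManifold.chart_mem_maximalAtlas c
  -- the function read in the chart, extended by zero
  let f' : EuclideanSpace ℝ (Fin n) → ℝ := e.target.indicator (f ∘ e.symm)
  let S := e '' tsupport f
  have hSc : IsCompact S :=
    hfc.isCompact.image_of_continuousOn (e.continuousOn.mono (hfU.trans Set.inter_subset_right))
  have hf'0 : ∀ y, y ∉ S → f' y = 0 := by
    intro y hy
    by_cases hyt : y ∈ e.target
    · simp only [f', Set.indicator_of_mem hyt, Function.comp]
      refine image_eq_zero_of_notMem_tsupport fun h => hy ⟨_, h, e.right_inv hyt⟩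
    · exact Set.indicator_of_notMem hyt _
  have hSU : S ⊆ e '' (Ω ∩ e.source) := Set.image_mono hfU
  have hf'S : tsupport f' ⊆ S :=
    closure_minimal (fun y hy => by_contra fun h => hy (hf'0 y h)) hSc.isClosed
  have hf'c : HasCompactSupport f' := HasCompactSupport.intro hSc hf'0
  have hoU : IsOpen (e '' (Ω ∩ e.source)) :=
    e.isOpen_image_of_subset_source (hΩ.inter e.open_source) Set.inter_subset_right
  have hUt : e '' (Ω ∩ e.source) ⊆ e.target :=
    Set.image_subset_iff.2 fun y hy => e.map_source hy.2
  have hf'1 : ContDiff ℝ 1 f' := by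
    rw [contDiff_iff_contDiffAt]
    intro y
    by_cases hyt : y ∈ e.target
    · have h1 : ContMDiffAt (𝓡 n) 𝓘(ℝ, ℝ) 1 (f ∘ e.symm) y :=
        hf.contMDiffAt.comp y ((contMDiffOn_symm_of_mem_maximalAtlas heA1).contMDiffAt
          (e.open_target.mem_nhds hyt))
      refine h1.contDiffAt.congr_of_eventuallyEq ?_
      filter_upwards [e.open_target.mem_nhds hyt] with z hz
      exact Set.indicator_of_mem hz _
    · have : y ∈ Sᶜ := fun h => hyt (hUt (hSU h))
      refine contDiffAt_const (c := (0 : ℝ)) |>.congr_of_eventuallyEq ?_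
      filter_upwards [hSc.isClosed.isOpen_compl.mem_nhds this] with z hz
      exact hf'0 z hz
  obtain ⟨K', hK', hK'U, hfK', happ⟩ :=
    exists_contDiff_approx_fderiv hf'1 hf'c hoU (hf'S.trans hSU)
  have hK't : K' ⊆ e.target := hK'U.trans hUt
  set K := e.symm '' K' with hKdef
  have hKs : K ⊆ e.source := Set.image_subset_iff.2 fun y hy => e.map_target (hK't hy)
  have hKΩ : K ⊆ Ω := by
    rintro _ ⟨y, hy, rfl⟩
    obtain ⟨x, hx, rfl⟩ := hK'U hy
    rw [e.left_inv hx.2]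
    exact hx.1
  have hKc : IsCompact K := hK'.image_of_continuousOn (e.symm.continuousOn.mono hK't)
  -- a function vanishing off `K'` in the chart has support in `K`
  have hsupp : ∀ G : EuclideanSpace ℝ (Fin n) → ℝ, tsupport G ⊆ K' →
      tsupport (e.source.indicator (G ∘ e)) ⊆ K := by
    intro G hG
    refine closure_minimal (fun x hx => ?_) hKc.isClosed
    have hxs : x ∈ e.source := by_contra fun h => hx (Set.indicator_of_notMem h _)
    refine ⟨e x, hG (subset_tsupport _ ?_), e.left_inv hxs⟩
    rw [Function.mem_support, Set.indicator_of_mem hxs] at hx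
    exact hx
  have hff' : f = e.source.indicator (f' ∘ e) := by
    funext x
    by_cases hx : x ∈ e.source
    · simp [Set.indicator_of_mem hx, f', Set.indicator_of_mem (e.map_source hx), e.left_inv hx]
    · rw [Set.indicator_of_notMem hx]
      exact image_eq_zero_of_notMem_tsupport fun h => hx (hfU h).2
  -- the chain rule in the chart
  have hgrad : ∀ G : EuclideanSpace ℝ (Fin n) → ℝ, Differentiable ℝ G → ∀ x ∈ e.source, ∀ k,
      hGrad X (e.source.indicator (G ∘ e)) x k =
        fderiv ℝ G (e x) (mfderiv (𝓡 n) 𝓘(ℝ, EuclideanSpace ℝ (Fin n)) e x (X k x)) := by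
    intro G hG x hx k
    have h1 : e.source.indicator (G ∘ e) =ᶠ[𝓝 x] G ∘ e := by
      filter_upwards [e.open_source.mem_nhds hx] with z hz
      exact Set.indicator_of_mem hz _
    rw [hGrad_congr h1]
    have h2 : MDifferentiableAt (𝓡 n) 𝓘(ℝ, EuclideanSpace ℝ (Fin n)) e x :=
      mdifferentiableAt_atlas (chart_mem_atlas _ c) hx
    have h3 := (hG (e x)).hasFDerivAt.hasMFDerivAt.comp x h2.hasMFDerivAt
    simp only [hGrad, h3.mfderiv]
    rfl
  have hbd : ∀ k, ∃ C, ∀ x ∈ K, @norm (EuclideanSpace ℝ (Fin n)) _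
      (mfderiv (𝓡 n) 𝓘(ℝ, EuclideanSpace ℝ (Fin n)) e x (X k x)) ≤ C := fun k =>
    hKc.exists_bound_of_continuousOn ((continuousOn_mfderiv_apply hX k e.open_source
      (contMDiffOn_of_mem_maximalAtlas heA1)).mono hKs)
  choose C hC using hbd
  refine ⟨K, hKc, hKΩ, by rw [hff']; exact hsupp _ hfK', fun ε hε => ?_⟩
  set B := 1 + ∑ k, |C k| with hB
  have hB1 : 1 ≤ B := le_add_of_nonneg_right (Finset.sum_nonneg fun _ _ => abs_nonneg _)
  have hB0 : 0 < B := by linarith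
  obtain ⟨G, hG, hGK, hGe⟩ := happ (ε / B) (by positivity)
  have hεB : ε / B ≤ ε := div_le_self hε.le hB1
  have hGs : tsupport (e.source.indicator (G ∘ e)) ⊆ K := hsupp G hGK
  refine ⟨e.source.indicator (G ∘ e), ⟨?_, HasCompactSupport.of_support_subset_isCompact hKc
    ((subset_tsupport _).trans hGs), hGs.trans hKΩ⟩, hGs, fun x => ⟨?_, ?_⟩⟩
  · refine contMDiff_of_tsupport fun x hx => ?_
    have hxs := hKs (hGs hx)
    have h1 : ContMDiffAt (𝓡 n) 𝓘(ℝ, ℝ) ∞ (G ∘ e) x :=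
      hG.contMDiff.contMDiffAt.comp x ((contMDiffOn_of_mem_maximalAtlas heA).contMDiffAt
        (e.open_source.mem_nhds hxs))
    refine h1.congr_of_eventuallyEq ?_
    filter_upwards [e.open_source.mem_nhds hxs] with z hz
    exact Set.indicator_of_mem hz _
  · by_cases hx : x ∈ e.source
    · rw [hff']
      simp only [Set.indicator_of_mem hx, Function.comp]
      exact (hGe _).1.trans hεB
    · rw [hff']
      simp [Set.indicator_of_notMem hx, hε.le]
  · by_cases hx : x ∈ K
    · have hk : ∀ k, |(hGrad X f x - hGrad X (e.source.indicator (G ∘ e)) x) k| ≤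
          ε / B * |C k| := by
        intro k
        rw [PiLp.sub_apply, hgrad G (hG.differentiable (by simp)) x (hKs hx)]
        nth_rw 1 [hff']
        rw [hgrad f' (hf'1.differentiable one_ne_zero) x (hKs hx)]
        refine ((fderiv ℝ f' (e x) - fderiv ℝ G (e x)).le_opNorm
          (mfderiv (𝓡 n) 𝓘(ℝ, EuclideanSpace ℝ (Fin n)) e x (X k x))).trans ?_
        exact mul_le_mul (hGe _).2 ((hC k x hx).trans (le_abs_self _)) (norm_nonneg _)
          (by positivity)
      calc ‖hGrad X f x - hGrad X (e.source.indicator (G ∘ e)) x‖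
          ≤ ∑ k, |(hGrad X f x - hGrad X (e.source.indicator (G ∘ e)) x) k| := by
            rw [EuclideanSpace.norm_eq]
            refine Real.sqrt_le_iff.2 ⟨Finset.sum_nonneg fun _ _ => abs_nonneg _, ?_⟩
            simp only [Real.norm_eq_abs]
            exact Finset.sum_sq_le_sq_sum_of_nonneg fun _ _ => abs_nonneg _
        _ ≤ ∑ k, ε / B * |C k| := Finset.sum_le_sum fun k _ => hk k
        _ = ε / B * ∑ k, |C k| := by rw [Finset.mul_sum]
        _ ≤ ε / B * B := by gcongr; rw [hB]; linarith
        _ = ε := div_mul_cancel₀ _ hB0.ne'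
    · rw [hGrad_of_notMem_tsupport (fun h => hx (hGs h)),
        hGrad_of_notMem_tsupport (fun h => hx ?_)]
      · simpa using hε.le
      · rw [hff'] at h
        exact hsupp f' hfK' h

/-- Compactly supported `C¹` functions are `C¹`-limits of test functions: localize with a partition
of unity subordinate to the charts and mollify in each chart. -/
lemma isTestLimit_of_contMDiff [T2Space M] [SecondCountableTopology M] [IsManifold (𝓡 n) ∞ M]
    {X : Fin N → (x : M) → TangentSpace (𝓡 n) x} (hX : SmoothFields X) {Ω : Set M}
    (hΩ : IsOpen Ω) {f : M → ℝ} (hf : ContMDiff (𝓡 n) 𝓘(ℝ, ℝ) 1 f)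
    (hfc : HasCompactSupport f) (hfΩ : tsupport f ⊆ Ω) :
    IsTestLimit X Ω f := by
  have : LocallyCompactSpace M := ChartedSpace.locallyCompactSpace (EuclideanSpace ℝ (Fin n)) M
  obtain ⟨χ, hχ⟩ := SmoothPartitionOfUnity.exists_isSubordinate_chartAt_source (𝓡 n) M
  have hfin : {i | (Function.support (χ i) ∩ tsupport f).Nonempty}.Finite :=
    χ.locallyFinite.finite_nonempty_inter_compact hfc.isCompact
  have hχ1 : ∀ i, ContMDiff (𝓡 n) 𝓘(ℝ, ℝ) 1 (fun x => χ i x * f x) := fun i =>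
    ((χ i).contMDiff.of_le (by simp)).mul hf
  have hts : ∀ i, tsupport (fun x => χ i x * f x) ⊆ tsupport f := fun i =>
    closure_mono fun x hx h => hx (by simp [h])
  have key : ∀ s : Finset M, ContMDiff (𝓡 n) 𝓘(ℝ, ℝ) 1 (fun x => ∑ i ∈ s, χ i x * f x) ∧
      IsTestLimit X Ω (fun x => ∑ i ∈ s, χ i x * f x) := by
    intro s
    classical
    induction s using Finset.induction_on with
    | empty => simpa using ⟨contMDiff_const, isTestLimit_zero⟩
    | insert i s hi ih =>
      simp only [Finset.sum_insert hi]
      refine ⟨(hχ1 i).add ih.1, IsTestLimit.add (hχ1 i) ih.1 ?_ ih.2⟩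
      refine isTestLimit_of_chart hX hΩ (hχ1 i) (hfc.mono' ?_) i ?_
      · exact (subset_tsupport _).trans (hts i)
      · refine Set.subset_inter ((hts i).trans hfΩ) ?_
        have hs : Function.support (fun x => χ i x * f x) ⊆ Function.support (χ i) :=
          fun x hx h => hx (by simp [h])
        exact (closure_mono hs).trans (hχ i)
  have hsum : f = fun x => ∑ i ∈ hfin.toFinset, χ i x * f x := by
    funext x
    rw [← Finset.sum_mul]
    by_cases hx : f x = 0
    · simp [hx]
    · have h1 : ∑ i ∈ hfin.toFinset, χ i x = 1 := by
        rw [← χ.sum_eq_one (Set.mem_univ x)]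
        refine (finsum_eq_sum_of_support_subset _ fun i hi => ?_).symm
        simpa using ⟨x, hi, subset_tsupport f hx⟩
      rw [h1, one_mul]
  rw [hsum]
  exact (key _).2

end Approximation

/-! ### Membership in `W₀^{1,p(·)}` -/

section TestFunctions

variable {n N : ℕ} {M : Type*} [TopologicalSpace M]

lemma exists_indicator_bound {F : Type*} [NormedAddCommGroup F] {f : M → F}
    {K : Set M} (hK : IsCompact K) (hf : ContinuousOn f K) (h0 : ∀ x ∉ K, f x = 0) :
    ∃ B, 0 ≤ B ∧ ∀ x, ‖f x‖ ≤ K.indicator (fun _ => B) x := by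
  obtain ⟨B, hB⟩ := hK.exists_bound_of_continuousOn hf
  refine ⟨max B 0, le_max_right _ _, fun x => ?_⟩
  by_cases hx : x ∈ K
  · rw [Set.indicator_of_mem hx]
    exact (hB x hx).trans (le_max_left _ _)
  · rw [Set.indicator_of_notMem hx, h0 x hx, norm_zero]

variable [ChartedSpace (EuclideanSpace ℝ (Fin n)) M]
  {X : Fin N → (x : M) → TangentSpace (𝓡 n) x} {Ω : Set M}

lemma IsTest.continuous {φ : M → ℝ} (h : IsTest n Ω φ) : Continuous φ := h.1.continuous

lemma IsTest.continuous_hGrad [IsManifold (𝓡 n) ∞ M] (hX : SmoothFields X) {φ : M → ℝ}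
    (h : IsTest n Ω φ) : Continuous (hGrad X φ) := by
  rw [← continuousOn_univ]
  exact continuousOn_hGrad hX isOpen_univ h.contMDiff_one.contMDiffOn

/-- The classical horizontal gradient of a test function is its weak horizontal gradient. -/
lemma IsTest.isWeakHGrad [MeasurableSpace M] {μ : Measure M} {η : M → ℝ} (hη : IsTest n Ω η) :
    IsWeakHGrad μ X Ω η (hGrad X η) := by
  intro k φ ψ _ _ hadj
  have h := hadj η ⟨hη.1, hη.2.1, Set.subset_univ _⟩
  rw [setIntegral_eq_integral_of_forall_compl_eq_zero,
    setIntegral_eq_integral_of_forall_compl_eq_zero]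
  · simpa only [mul_comm] using h.symm
  · intro x hx
    rw [hGrad_of_notMem_tsupport fun h => hx (hη.2.2 h)]
    simp
  · intro x hx
    rw [image_eq_zero_of_notMem_tsupport fun h => hx (hη.2.2 h), zero_mul]

lemma memVarLp_of_compact {M : Type*} [TopologicalSpace M] [T2Space M] [MeasurableSpace M]
    [BorelSpace M] {μ : Measure M} {Ω : Set M} {p : M → ℝ} {pp : ℝ} [IsLocallyFiniteMeasure μ]
    (hp : ∀ᵐ x ∂μ.restrict Ω, 1 ≤ p x ∧ p x ≤ pp)
    {F : Type*} [NormedAddCommGroup F] [SecondCountableTopologyEither M F] {f : M → F}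
    {K : Set M} (hK : IsCompact K) (hf : Continuous f) (h0 : ∀ x ∉ K, f x = 0) :
    MemVarLp μ Ω p f := by
  obtain ⟨B, -, hB⟩ := exists_indicator_bound hK hf.continuousOn h0
  exact memVarLp_of_bounded hp hf.aestronglyMeasurable hK.measurableSet hK.measure_lt_top
    (Eventually.of_forall hB)

lemma IsTest.memVarLp {n : ℕ} {M : Type*} [TopologicalSpace M] [T2Space M]
    [ChartedSpace (EuclideanSpace ℝ (Fin n)) M] [MeasurableSpace M]
    [BorelSpace M] {μ : Measure M} {Ω : Set M} {p : M → ℝ} {pp : ℝ} [IsLocallyFiniteMeasure μ]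
    (hp : ∀ᵐ x ∂μ.restrict Ω, 1 ≤ p x ∧ p x ≤ pp) {φ : M → ℝ} (h : IsTest n Ω φ) :
    MemVarLp μ Ω p φ :=
  memVarLp_of_compact hp h.2.1.isCompact h.continuous
    fun _ hx => image_eq_zero_of_notMem_tsupport hx

end TestFunctions

section Sobolev

variable {n N : ℕ} {M : Type*} [TopologicalSpace M] [T2Space M]
  [ChartedSpace (EuclideanSpace ℝ (Fin n)) M] [IsManifold (𝓡 n) ∞ M]
  [MeasurableSpace M] [BorelSpace M] {μ : Measure M}
  {X : Fin N → (x : M) → TangentSpace (𝓡 n) x} {Ω : Set M} {p : M → ℝ} {pp : ℝ}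

lemma IsTest.memVarLp_hGrad [IsLocallyFiniteMeasure μ]
    (hp : ∀ᵐ x ∂μ.restrict Ω, 1 ≤ p x ∧ p x ≤ pp) (hX : SmoothFields X) {φ : M → ℝ}
    (h : IsTest n Ω φ) : MemVarLp μ Ω p (hGrad X φ) :=
  memVarLp_of_compact hp h.2.1.isCompact (h.continuous_hGrad hX)
    fun _ hx => hGrad_of_notMem_tsupport hx

/-- The test functions approximating an element of `W₀^{1,p(·)}`, with convergence in modular. -/
lemma MemW0.exists_modular_approx [IsLocallyFiniteMeasure μ]
    (hp : ∀ᵐ x ∂μ.restrict Ω, 1 ≤ p x ∧ p x ≤ pp) (hpm : AEMeasurable p (μ.restrict Ω))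
    (hX : SmoothFields X) {u : M → ℝ} {w : M → EuclideanSpace ℝ (Fin N)}
    (h : MemW0 μ X Ω p u w) :
    ∃ φ : ℕ → M → ℝ, (∀ i, IsTest n Ω (φ i)) ∧
      Tendsto (fun i => modular μ Ω p (fun x => u x - φ i x)) atTop (𝓝 0) ∧
      Tendsto (fun i => modular μ Ω p (fun x => w x - hGrad X (φ i) x)) atTop (𝓝 0) := by
  obtain ⟨⟨hu, hw, -⟩, φ, hφ, hlim⟩ := h
  refine ⟨φ, hφ, tendsto_modular_of_luxNorm hp
    (fun i => (hu.sub hp hpm ((hφ i).memVarLp hp)).2) ?_, tendsto_modular_of_luxNorm hp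
    (fun i => (hw.sub hp hpm ((hφ i).memVarLp_hGrad hp hX)).2) ?_⟩
  · exact squeeze_zero (fun _ => luxNorm_nonneg _)
      (fun _ => le_add_of_nonneg_right (luxNorm_nonneg _)) hlim
  · exact squeeze_zero (fun _ => luxNorm_nonneg _)
      (fun _ => le_add_of_nonneg_left (luxNorm_nonneg _)) hlim

/-- A pair which is a modular limit of test functions and their gradients lies in
`W₀^{1,p(·)}`: the identity defining the weak gradient holds for test functions and passes to the
limit, the test functions in it being bounded with compact support. -/
lemma memW0_of_modular_approx [IsLocallyFiniteMeasure μ]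
    (hp : ∀ᵐ x ∂μ.restrict Ω, 1 ≤ p x ∧ p x ≤ pp) (hpm : AEMeasurable p (μ.restrict Ω))
    (hX : SmoothFields X) {u : M → ℝ} {w : M → EuclideanSpace ℝ (Fin N)}
    (hu : AEStronglyMeasurable u (μ.restrict Ω)) (hw : AEStronglyMeasurable w (μ.restrict Ω))
    {η : ℕ → M → ℝ} (hη : ∀ i, IsTest n Ω (η i))
    (h1 : Tendsto (fun i => modular μ Ω p (fun x => u x - η i x)) atTop (𝓝 0))
    (h2 : Tendsto (fun i => modular μ Ω p (fun x => w x - hGrad X (η i) x)) atTop (𝓝 0)) :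
    MemW0 μ X Ω p u w := by
  have hu' : MemVarLp μ Ω p u := by
    obtain ⟨i, hi⟩ := (h1.eventually (gt_mem_nhds ENNReal.zero_lt_top)).exists
    have := MemVarLp.add hp hpm (f := fun x => u x - η i x)
      ⟨hu.sub (hη i).continuous.aestronglyMeasurable, hi⟩ ((hη i).memVarLp hp)
    simpa using this
  have hw' : MemVarLp μ Ω p w := by
    obtain ⟨i, hi⟩ := (h2.eventually (gt_mem_nhds ENNReal.zero_lt_top)).exists
    have := MemVarLp.add hp hpm (f := fun x => w x - hGrad X (η i) x)
      ⟨hw.sub ((hη i).continuous_hGrad hX).aestronglyMeasurable, hi⟩ ((hη i).memVarLp_hGrad hp hX)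
    simpa using this
  refine ⟨⟨hu', hw', fun k φ ψ hφ hψ hadj => ?_⟩, η, hη, ?_⟩
  · obtain ⟨B, hB0, hB⟩ := exists_indicator_bound hψ.2.1.isCompact hψ.continuous.continuousOn
      fun _ hx => image_eq_zero_of_notMem_tsupport hx
    obtain ⟨B', hB0', hB'⟩ := exists_indicator_bound hφ.2.1.isCompact hφ.continuous.continuousOn
      fun _ hx => image_eq_zero_of_notMem_tsupport hx
    have hKψ := hψ.2.1.isCompact
    have hKφ := hφ.2.1.isCompact
    have hk : ∀ {f : M → EuclideanSpace ℝ (Fin N)}, MemVarLp μ Ω p f →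
        MemVarLp μ Ω p (fun x => f x k) := fun {f} hf =>
      ⟨(EuclideanSpace.proj k :
        EuclideanSpace ℝ (Fin N) →L[ℝ] ℝ).continuous.comp_aestronglyMeasurable hf.1, (modular_mono (hp.mono fun x hx => by linarith [hx.1])
          (Eventually.of_forall fun x => PiLp.norm_apply_le _ _)).trans_lt hf.2⟩
    have hkd : Tendsto (fun i => modular μ Ω p (fun x => w x k - hGrad X (η i) x k)) atTop
        (𝓝 0) :=
      tendsto_of_tendsto_of_tendsto_of_le_of_le tendsto_const_nhds h2 (fun _ => zero_le)
        fun i => modular_mono (hp.mono fun x hx => by linarith [hx.1])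
          (Eventually.of_forall fun x => PiLp.norm_apply_le (w x - hGrad X (η i) x) k)
    have hl1 := tendsto_integral_mul_of_modular hp h1 hKψ.measurableSet hKψ.measure_lt_top hB0 hB
    have hl2 := tendsto_integral_mul_of_modular hp hkd hKφ.measurableSet hKφ.measure_lt_top
      hB0' hB'
    -- the defect of the identity for `u` is the defect for `u - η i`, whatever `i`
    have hdef : ∀ i, (∫ x in Ω, (u x - η i x) * ψ x ∂μ) -
        (∫ x in Ω, (w x k - hGrad X (η i) x k) * φ x ∂μ) =
        (∫ x in Ω, u x * ψ x ∂μ) - ∫ x in Ω, w x k * φ x ∂μ := by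
      intro i
      have e1 := (hη i).isWeakHGrad k φ ψ hφ hψ hadj
      simp only [sub_mul]
      rw [integral_sub, integral_sub, e1]
      · ring
      · exact integrable_mul_of_memVarLp hp (hk hw') hφ.continuous.aestronglyMeasurable
          hKφ.measurableSet hKφ.measure_lt_top hB0' hB'
      · exact integrable_mul_of_memVarLp hp (hk ((hη i).memVarLp_hGrad hp hX))
          hφ.continuous.aestronglyMeasurable hKφ.measurableSet hKφ.measure_lt_top hB0' hB'
      · exact integrable_mul_of_memVarLp hp hu' hψ.continuous.aestronglyMeasurable
          hKψ.measurableSet hKψ.measure_lt_top hB0 hB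
      · exact integrable_mul_of_memVarLp hp ((hη i).memVarLp hp)
          hψ.continuous.aestronglyMeasurable hKψ.measurableSet hKψ.measure_lt_top hB0 hB
    have hl := hl1.sub hl2
    simp only [hdef, sub_zero] at hl
    exact sub_eq_zero.1 (tendsto_nhds_unique tendsto_const_nhds hl)
  · simpa using (tendsto_luxNorm_of_modular hp h1).add (tendsto_luxNorm_of_modular hp h2)

/-- A compactly supported `C¹` function is approximated by test functions in modular. -/
lemma exists_test_modular_le [SecondCountableTopology M] [IsLocallyFiniteMeasure μ]
    (hp : ∀ᵐ x ∂μ.restrict Ω, 1 ≤ p x ∧ p x ≤ pp)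
    (hX : SmoothFields X) (hΩ : IsOpen Ω) {f : M → ℝ} (hf : ContMDiff (𝓡 n) 𝓘(ℝ, ℝ) 1 f)
    (hfc : HasCompactSupport f) (hfΩ : tsupport f ⊆ Ω) {ε : ENNReal} (hε : 0 < ε) :
    ∃ η : M → ℝ, IsTest n Ω η ∧ modular μ Ω p (fun x => f x - η x) ≤ ε ∧
      modular μ Ω p (fun x => hGrad X f x - hGrad X η x) ≤ ε := by
  obtain ⟨K, hK, -, hfK, happ⟩ := isTestLimit_of_contMDiff hX hΩ hf hfc hfΩ
  -- for functions supported in `K` and bounded by `δ ≤ 1` the modular is at most `δ μ(K)`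
  have key : ∀ {F : Type} [NormedAddCommGroup F] (h : M → F) (δ : ℝ), 0 < δ → δ ≤ 1 →
      (∀ x ∉ K, h x = 0) → (∀ x, ‖h x‖ ≤ δ) → modular μ Ω p h ≤ ENNReal.ofReal δ * μ K := by
    intro F _ h δ hδ hδ1 h0 hb
    calc modular μ Ω p h ≤ ∫⁻ x in Ω, K.indicator (fun _ => ENNReal.ofReal δ) x ∂μ := by
          refine lintegral_mono_ae ?_
          filter_upwards [hp] with x hx
          by_cases hxK : x ∈ K
          · rw [Set.indicator_of_mem hxK]
            refine ENNReal.ofReal_le_ofReal ?_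
            calc ‖h x‖ ^ p x ≤ δ ^ p x :=
                  Real.rpow_le_rpow (norm_nonneg _) (hb x) (by linarith)
              _ ≤ δ ^ (1 : ℝ) := Real.rpow_le_rpow_of_exponent_ge hδ hδ1 hx.1
              _ = δ := Real.rpow_one δ
          · rw [Set.indicator_of_notMem hxK, h0 x hxK, norm_zero,
              Real.zero_rpow (by linarith)]
            simp
      _ = ENNReal.ofReal δ * μ.restrict Ω K := lintegral_indicator_const hK.measurableSet _
      _ ≤ _ := mul_le_mul_right (Measure.restrict_apply_le _ _) _
  have hlim : Tendsto (fun δ : ℝ => ENNReal.ofReal δ * μ K) (𝓝[>] 0) (𝓝 0) := by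
    have h0 : Tendsto (fun δ : ℝ => ENNReal.ofReal δ) (𝓝[>] 0) (𝓝 0) := by
      have : Tendsto (fun δ : ℝ => δ) (𝓝[>] (0 : ℝ)) (𝓝 0) := nhdsWithin_le_nhds
      simpa using ENNReal.tendsto_ofReal this
    simpa using ENNReal.Tendsto.mul_const h0 (Or.inr hK.measure_lt_top.ne)
  obtain ⟨δ, hδε, hδ, hδ1⟩ := ((hlim.eventually (ge_mem_nhds hε)).and
    (Ioc_mem_nhdsGT (zero_lt_one' ℝ))).exists
  obtain ⟨η, hη, hηK, hb⟩ := happ δ hδ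
  refine ⟨η, hη, (key _ δ hδ hδ1 ?_ fun x => (hb x).1).trans hδε,
    (key _ δ hδ hδ1 ?_ fun x => (hb x).2).trans hδε⟩
  · intro x hx
    rw [image_eq_zero_of_notMem_tsupport fun h => hx (hfK h),
      image_eq_zero_of_notMem_tsupport fun h => hx (hηK h), sub_zero]
  · intro x hx
    rw [hGrad_of_notMem_tsupport fun h => hx (hfK h),
      hGrad_of_notMem_tsupport fun h => hx (hηK h), sub_zero]

/-- A modular limit of compactly supported `C¹` functions lies in `W₀^{1,p(·)}`. -/
lemma memW0_of_contMDiff_approx [SecondCountableTopology M] [IsLocallyFiniteMeasure μ]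
    (hp : ∀ᵐ x ∂μ.restrict Ω, 1 ≤ p x ∧ p x ≤ pp) (hpm : AEMeasurable p (μ.restrict Ω))
    (hX : SmoothFields X) (hΩ : IsOpen Ω) {u : M → ℝ} {w : M → EuclideanSpace ℝ (Fin N)}
    (hu : AEStronglyMeasurable u (μ.restrict Ω)) (hw : AEStronglyMeasurable w (μ.restrict Ω))
    {f : ℕ → M → ℝ} (hf : ∀ i, ContMDiff (𝓡 n) 𝓘(ℝ, ℝ) 1 (f i))
    (hfc : ∀ i, HasCompactSupport (f i)) (hfΩ : ∀ i, tsupport (f i) ⊆ Ω)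
    (h1 : Tendsto (fun i => modular μ Ω p (fun x => u x - f i x)) atTop (𝓝 0))
    (h2 : Tendsto (fun i => modular μ Ω p (fun x => w x - hGrad X (f i) x)) atTop (𝓝 0)) :
    MemW0 μ X Ω p u w := by
  have hpos : ∀ i : ℕ, (0 : ENNReal) < (i : ENNReal)⁻¹ := fun i => by simp
  choose η hη he1 he2 using fun i =>
    exists_test_modular_le hp hX hΩ (hf i) (hfc i) (hfΩ i) (hpos i)
  have hgc : ∀ i, AEStronglyMeasurable (hGrad X (f i)) (μ.restrict Ω) := fun i =>
    (continuousOn_univ.1 (continuousOn_hGrad hX isOpen_univ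
      (hf i).contMDiffOn)).aestronglyMeasurable
  have hlim : ∀ {a : ℕ → ENNReal}, Tendsto a atTop (𝓝 0) →
      Tendsto (fun i => ENNReal.ofReal (2 ^ pp) * (a i + (i : ENNReal)⁻¹)) atTop (𝓝 0) := by
    intro a ha
    have := ENNReal.Tendsto.const_mul (ha.add ENNReal.tendsto_inv_nat_nhds_zero)
      (a := ENNReal.ofReal (2 ^ pp)) (Or.inr ENNReal.ofReal_ne_top)
    simpa using this
  refine memW0_of_modular_approx hp hpm hX hu hw hη ?_ ?_
  · refine tendsto_of_tendsto_of_tendsto_of_le_of_le tendsto_const_nhds (hlim h1)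
      (fun _ => zero_le) fun i => ?_
    have := modular_add_le hp hpm (f := fun x => u x - f i x) (g := fun x => f i x - η i x)
      (hu.sub (hf i).continuous.aestronglyMeasurable)
    simp only [sub_add_sub_cancel] at this
    exact this.trans (mul_le_mul_right (add_le_add_right (he1 i) _) _)
  · refine tendsto_of_tendsto_of_tendsto_of_le_of_le tendsto_const_nhds (hlim h2)
      (fun _ => zero_le) fun i => ?_
    have := modular_add_le hp hpm (f := fun x => w x - hGrad X (f i) x)
      (g := fun x => hGrad X (f i) x - hGrad X (η i) x) (hw.sub (hgc i))
    simp only [sub_add_sub_cancel] at this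
    exact this.trans (mul_le_mul_right (add_le_add_right (he2 i) _) _)

end Sobolev

/-! ### The quotient test function -/

section Scalar

lemma rpow_le_of_ge {ε h r R : ℝ} (hε : 0 < ε) (hε1 : ε ≤ 1) (hh : ε ≤ h) (hr : r ≤ 0)
    (hR : R ≤ r) : h ^ r ≤ ε ^ R :=
  (Real.rpow_le_rpow_of_nonpos hε hh hr).trans (Real.rpow_le_rpow_of_exponent_ge hε hε1 hR)

/-- The functions of `h` occurring in the gradient of `a h^{1-p}` are bounded on `[ε, ∞)`, uniformly
in the exponent. For the one with the logarithm this uses that the exponents stay away from `1`. -/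
lemma exists_rpow_bounds {ε pm pp : ℝ} (hε : 0 < ε) (hε1 : ε ≤ 1) (hpm : 1 < pm) :
    ∃ E, 0 ≤ E ∧ ∀ h q : ℝ, ε ≤ h → pm ≤ q → q ≤ pp →
      |h ^ (1 - q)| ≤ E ∧ |h ^ (-q)| ≤ E ∧ |h ^ (1 - q) * Real.log h| ≤ E := by
  refine ⟨max (ε ^ (-pp)) (max ((pm - 1)⁻¹) (ε ^ (1 - pp) * |Real.log ε|)),
    (Real.rpow_nonneg hε.le _).trans (le_max_left _ _), fun h q hh hq hQ => ?_⟩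
  have h0 : 0 < h := hε.trans_le hh
  have h1 : h ^ (1 - q) ≤ ε ^ (1 - pp) := rpow_le_of_ge hε hε1 hh (by linarith) (by linarith)
  refine ⟨?_, ?_, ?_⟩
  · rw [abs_of_pos (by positivity)]
    exact (h1.trans (Real.rpow_le_rpow_of_exponent_ge hε hε1 (by linarith))).trans
      (le_max_left _ _)
  · rw [abs_of_pos (by positivity)]
    exact (rpow_le_of_ge hε hε1 hh (by linarith) (by linarith)).trans (le_max_left _ _)
  · refine le_trans ?_ (le_max_right _ _)
    rw [abs_mul, abs_of_pos (by positivity : 0 < h ^ (1 - q))]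
    rcases le_total 1 h with hh1 | hh1
    · refine le_trans ?_ (le_max_left _ _)
      rw [abs_of_nonneg (Real.log_nonneg hh1)]
      calc h ^ (1 - q) * Real.log h ≤ h ^ (1 - q) * (h ^ (q - 1) / (q - 1)) := by
            gcongr
            exact Real.log_le_rpow_div h0.le (by linarith)
        _ = (q - 1)⁻¹ := by
            rw [← mul_div_assoc, ← Real.rpow_add h0]
            simp
        _ ≤ (pm - 1)⁻¹ := inv_anti₀ (by linarith) (by linarith)
    · refine le_trans ?_ (le_max_right _ _)
      refine mul_le_mul h1 ?_ (abs_nonneg _) (by positivity)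
      rw [abs_of_nonpos (Real.log_nonpos h0.le hh1), abs_of_nonpos (Real.log_nonpos hε.le hε1)]
      exact neg_le_neg (Real.log_le_log hε hh)

/-- Differential of `a h^{1-p}` with `h = ε + √(v² + η)`. -/
lemma hasFDerivAt_quotient {E : Type*} [NormedAddCommGroup E] [NormedSpace ℝ E]
    {a p v : E → ℝ} {a' p' v' : E →L[ℝ] ℝ} {y : E} {ε η : ℝ} (hε : 0 < ε) (hη : 0 < η)
    (ha : HasFDerivAt a a' y) (hp : HasFDerivAt p p' y) (hv : HasFDerivAt v v' y) :
    HasFDerivAt (fun z => a z * (ε + √(v z ^ 2 + η)) ^ (1 - p z))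
      ((ε + √(v y ^ 2 + η)) ^ (1 - p y) • a' -
        (a y * ((ε + √(v y ^ 2 + η)) ^ (1 - p y) * Real.log (ε + √(v y ^ 2 + η)))) • p' +
        ((1 - p y) * a y * (ε + √(v y ^ 2 + η)) ^ (-p y)) •
          ((v y / √(v y ^ 2 + η)) • v')) y := by
  have hS : 0 < v y ^ 2 + η := by positivity
  have hH : 0 < ε + √(v y ^ 2 + η) := by positivity
  have h1 : HasFDerivAt (fun z => ε + √(v z ^ 2 + η)) ((v y / √(v y ^ 2 + η)) • v') y := by
    have h := (((hv.pow 2).add_const η).sqrt hS.ne').const_add ε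
    refine h.congr_fderiv ?_
    ext z
    simp
    field_simp
  have h2 := ha.mul (h1.rpow (hp.const_sub 1) hH)
  refine h2.congr_fderiv ?_
  ext z
  simp [show 1 - p y - 1 = -p y by ring]
  ring

end Scalar

section Quotient

variable {n N : ℕ} {M : Type*} [TopologicalSpace M]
  [ChartedSpace (EuclideanSpace ℝ (Fin n)) M]
  {X : Fin N → (x : M) → TangentSpace (𝓡 n) x} {Ω : Set M} {p : M → ℝ}

/-- The horizontal gradient of `a h^{1-p}`, where `z` stands for the horizontal gradient of `h`. -/
noncomputable def quotGrad (X : Fin N → (x : M) → TangentSpace (𝓡 n) x) (p a h : M → ℝ)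
    (z : M → EuclideanSpace ℝ (Fin N)) (x : M) : EuclideanSpace ℝ (Fin N) :=
  h x ^ (1 - p x) • hGrad X a x - (a x * (h x ^ (1 - p x) * Real.log (h x))) • hGrad X p x +
    ((1 - p x) * a x * h x ^ (-p x)) • z x

lemma hGrad_quotient {a v : M → ℝ} {x : M} {ε η : ℝ} (hε : 0 < ε) (hη : 0 < η)
    (ha : MDifferentiableAt (𝓡 n) 𝓘(ℝ, ℝ) a x) (hp : MDifferentiableAt (𝓡 n) 𝓘(ℝ, ℝ) p x)
    (hv : MDifferentiableAt (𝓡 n) 𝓘(ℝ, ℝ) v x) :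
    hGrad X (fun x => a x * (ε + √(v x ^ 2 + η)) ^ (1 - p x)) x =
      quotGrad X p a (fun x => ε + √(v x ^ 2 + η))
        (fun x => (v x / √(v x ^ 2 + η)) • hGrad X v x) x := by
  obtain ⟨La, hLa⟩ := hasFDerivAt_chart ha
  obtain ⟨Lp, hLp⟩ := hasFDerivAt_chart hp
  obtain ⟨Lv, hLv⟩ := hasFDerivAt_chart hv
  have hH : ε + √(v x ^ 2 + η) ≠ 0 := by positivity
  have hcont : ContinuousAt (fun x => a x * (ε + √(v x ^ 2 + η)) ^ (1 - p x)) x :=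
    ha.continuousAt.mul ((continuousAt_const.add
      (((hv.continuousAt.pow 2).add continuousAt_const).sqrt)).rpow
      (continuousAt_const.sub hp.continuousAt) (Or.inl hH))
  ext k
  have h := hasFDerivAt_quotient hε hη hLa hLp hLv
  refine (hGrad_apply_of_hasFDerivAt hcont h k).trans ?_
  simp only [quotGrad, PiLp.add_apply, PiLp.sub_apply, PiLp.smul_apply,
    hGrad_apply_of_hasFDerivAt ha.continuousAt hLa, hGrad_apply_of_hasFDerivAt hp.continuousAt hLp,
    hGrad_apply_of_hasFDerivAt hv.continuousAt hLv]
  simp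
  rfl

lemma contMDiffOn_quotient {a v : M → ℝ} {ε η : ℝ} (hε : 0 < ε) (hη : 0 < η)
    (ha : ContMDiffOn (𝓡 n) 𝓘(ℝ, ℝ) 1 a Ω) (hp : ContMDiffOn (𝓡 n) 𝓘(ℝ, ℝ) 1 p Ω)
    (hv : ContMDiffOn (𝓡 n) 𝓘(ℝ, ℝ) 1 v Ω) :
    ContMDiffOn (𝓡 n) 𝓘(ℝ, ℝ) 1 (fun x => a x * (ε + √(v x ^ 2 + η)) ^ (1 - p x)) Ω := by
  have hG : ContDiff ℝ 1 (fun y : ℝ × ℝ × ℝ =>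
      y.1 * (ε + √(y.2.2 ^ 2 + η)) ^ (1 - y.2.1)) := by
    refine contDiff_fst.mul (ContDiff.rpow ?_ ?_ fun y => by positivity)
    · refine contDiff_const.add (ContDiff.sqrt ?_ fun y => by positivity)
      exact ((contDiff_snd.comp contDiff_snd).pow 2).add contDiff_const
    · exact contDiff_const.sub (contDiff_fst.comp contDiff_snd)
  exact hG.contMDiff.comp_contMDiffOn (ha.prodMk_space (hp.prodMk_space hv))

end Quotient

section QuotientSobolev

variable {n N : ℕ} {M : Type*} [TopologicalSpace M] [T2Space M] [SecondCountableTopology M]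
  [ChartedSpace (EuclideanSpace ℝ (Fin n)) M] [IsManifold (𝓡 n) ∞ M]
  [MeasurableSpace M] [BorelSpace M] {μ : Measure M}
  {X : Fin N → (x : M) → TangentSpace (𝓡 n) x} {Ω : Set M} {p : M → ℝ} {pm pp : ℝ}

/-- For a positive `v ∈ W₀^{1,p(·)}(Ω)` and a compactly supported `C¹` function `a`, the quotient
`a (v + ε)^{1-p}` belongs to `W₀^{1,p(·)}(Ω)`, and its gradient is given by the chain rule. It is
the limit of `a (ε + √(vᵢ² + ηᵢ))^{1-p}` where `vᵢ` are test functions converging to `v`; the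
square root keeps the base above `ε` although `vᵢ` may change sign. -/
theorem memW0_quotient [IsLocallyFiniteMeasure μ] (hX : SmoothFields X) (hΩ : IsOpen Ω)
    (hp : ContMDiffOn (𝓡 n) 𝓘(ℝ, ℝ) 1 p Ω) (hpm : 1 < pm)
    (hpb : ∀ x ∈ Ω, pm ≤ p x ∧ p x ≤ pp)
    {v : M → ℝ} {w : M → EuclideanSpace ℝ (Fin N)} (hv : MemW0 μ X Ω p v w)
    (hvpos : ∀ᵐ x ∂μ.restrict Ω, 0 < v x)
    {a : M → ℝ} (ha : ContMDiff (𝓡 n) 𝓘(ℝ, ℝ) 1 a) (hac : HasCompactSupport a)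
    (haΩ : tsupport a ⊆ Ω) {ε : ℝ} (hε : 0 < ε) (hε1 : ε ≤ 1) :
    MemW0 μ X Ω p (fun x => a x * (v x + ε) ^ (1 - p x))
      (quotGrad X p a (fun x => v x + ε) w) := by
  have hmem : ∀ᵐ x ∂μ.restrict Ω, x ∈ Ω := ae_restrict_mem hΩ.measurableSet
  have hp1 : ∀ᵐ x ∂μ.restrict Ω, 1 ≤ p x ∧ p x ≤ pp := by
    filter_upwards [hmem] with x hx
    exact ⟨hpm.le.trans (hpb x hx).1, (hpb x hx).2⟩
  have hpmeas : AEMeasurable p (μ.restrict Ω) := hp.continuousOn.aemeasurable hΩ.measurableSet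
  obtain ⟨E, hE0, hE⟩ := exists_rpow_bounds (pp := pp) hε hε1 hpm
  set K := tsupport a with hKdef
  have hK : IsCompact K := hac
  have hgp : ContinuousOn (hGrad X p) Ω := continuousOn_hGrad hX hΩ hp
  have hga : Continuous (hGrad X a) :=
    continuousOn_univ.1 (continuousOn_hGrad hX isOpen_univ ha.contMDiffOn)
  have ha0 : ∀ x ∉ K, a x = 0 := fun x hx => image_eq_zero_of_notMem_tsupport hx
  obtain ⟨B₁, hB₁0, hB₁⟩ := exists_indicator_bound hK ha.continuous.continuousOn ha0
  obtain ⟨B₂, hB₂0, hB₂⟩ := exists_indicator_bound hK hga.continuousOn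
    fun x hx => hGrad_of_notMem_tsupport hx
  obtain ⟨B₃, hB₃0, hB₃⟩ := exists_indicator_bound (f := fun x => a x • hGrad X p x) hK
    (ha.continuous.continuousOn.smul (hgp.mono haΩ)) fun x hx => by rw [ha0 x hx, zero_smul]
  -- approximation of `v`, almost everywhere along a subsequence
  obtain ⟨φ₀, hφ₀, hφ₀v, hφ₀w⟩ := hv.exists_modular_approx hp1 hpmeas hX
  obtain ⟨ns, hns, hae⟩ := exists_subseq_tendsto_ae_of_modular hp1 hpmeas
    (fun i => hv.1.1.1.sub (hφ₀ i).continuous.aestronglyMeasurable) hφ₀v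
  set φ : ℕ → M → ℝ := fun i => φ₀ (ns i) with hφdef
  have hφ : ∀ i, IsTest n Ω (φ i) := fun i => hφ₀ _
  have hφw : Tendsto (fun i => modular μ Ω p (fun x => w x - hGrad X (φ i) x)) atTop (𝓝 0) :=
    hφ₀w.comp hns.tendsto_atTop
  have hφae : ∀ᵐ x ∂μ.restrict Ω, Tendsto (fun i => φ i x) atTop (𝓝 (v x)) := by
    filter_upwards [hae] with x hx
    simpa [hφdef] using (tendsto_const_nhds (x := v x)).sub hx
  let η : ℕ → ℝ := fun i => 1 / ((i : ℝ) + 1)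
  have hη : ∀ i, 0 < η i := fun i => Nat.one_div_pos_of_nat
  have hηlim : Tendsto η atTop (𝓝 0) := tendsto_one_div_add_atTop_nhds_zero_nat
  let h : M → ℝ := fun x => v x + ε
  let H : ℕ → M → ℝ := fun i x => ε + √(φ i x ^ 2 + η i)
  let c : ℕ → M → ℝ := fun i x => φ i x / √(φ i x ^ 2 + η i)
  have hHε : ∀ i x, ε ≤ H i x := fun i x => le_add_of_nonneg_right (Real.sqrt_nonneg _)
  have hHc : ∀ i, Continuous (H i) := fun i =>
    continuous_const.add (((hφ i).continuous.pow 2).add continuous_const).sqrt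
  have hsq : ∀ i x, 0 < φ i x ^ 2 + η i := fun i x =>
    add_pos_of_nonneg_of_pos (sq_nonneg _) (hη i)
  have hcc : ∀ i, Continuous (c i) := fun i =>
    (hφ i).continuous.div (((hφ i).continuous.pow 2).add continuous_const).sqrt
      fun x => (Real.sqrt_pos.2 (hsq i x)).ne'
  have hc1 : ∀ i x, |c i x| ≤ 1 := fun i x => by
    rw [abs_div, abs_of_pos (Real.sqrt_pos.2 (hsq i x)), div_le_one (Real.sqrt_pos.2 (hsq i x))]
    exact Real.abs_le_sqrt (by linarith [(hη i).le])
  have hsqlim : ∀ᵐ x ∂μ.restrict Ω, Tendsto (fun i => √(φ i x ^ 2 + η i)) atTop (𝓝 (v x)) := by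
    filter_upwards [hφae, hvpos] with x hx hx0
    have := ((hx.pow 2).add hηlim).sqrt
    rwa [add_zero, Real.sqrt_sq hx0.le] at this
  have hHlim : ∀ᵐ x ∂μ.restrict Ω, Tendsto (fun i => H i x) atTop (𝓝 (h x)) := by
    filter_upwards [hsqlim] with x hx
    have := hx.const_add ε
    rwa [add_comm ε (v x)] at this
  have hclim : ∀ᵐ x ∂μ.restrict Ω, Tendsto (fun i => c i x) atTop (𝓝 1) := by
    filter_upwards [hφae, hvpos, hsqlim] with x hx hx0 hs
    have := hx.div hs hx0.ne'
    rwa [div_self hx0.ne'] at this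
  have hhε : ∀ᵐ x ∂μ.restrict Ω, ε ≤ h x := by
    filter_upwards [hvpos] with x hx
    exact le_add_of_nonneg_left hx.le
  -- measurability
  have hmh : AEMeasurable h (μ.restrict Ω) := hv.1.1.1.aemeasurable.add_const ε
  have hma : AEMeasurable a (μ.restrict Ω) := ha.continuous.aemeasurable
  have hmgp : AEStronglyMeasurable (hGrad X p) (μ.restrict Ω) :=
    hgp.aestronglyMeasurable hΩ.measurableSet
  have hmq : ∀ {f : M → ℝ} {z : M → EuclideanSpace ℝ (Fin N)}, AEMeasurable f (μ.restrict Ω) →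
      AEStronglyMeasurable z (μ.restrict Ω) →
      AEStronglyMeasurable (quotGrad X p a f z) (μ.restrict Ω) := by
    intro f z hf hz
    have h1 := hf.pow (hpmeas.const_sub 1)
    refine ((h1.aestronglyMeasurable.smul hga.aestronglyMeasurable).sub
      ((hma.mul (h1.mul (Real.measurable_log.comp_aemeasurable hf))).aestronglyMeasurable.smul
        hmgp)).add ?_
    exact (((hpmeas.const_sub 1).mul hma).mul (hf.pow hpmeas.neg)).aestronglyMeasurable.smul hz
  have hψ1 : ∀ i, ContMDiff (𝓡 n) 𝓘(ℝ, ℝ) 1 (fun x => a x * H i x ^ (1 - p x)) ∧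
      tsupport (fun x => a x * H i x ^ (1 - p x)) ⊆ K := by
    intro i
    have hsub : tsupport (fun x => a x * H i x ^ (1 - p x)) ⊆ K := tsupport_mul_subset_left
    exact ⟨contMDiff_of_isOpen_tsupport hΩ (contMDiffOn_quotient hε (hη i) ha.contMDiffOn hp
      (hφ i).contMDiff_one.contMDiffOn) (hsub.trans haΩ), hsub⟩
  have hψg : ∀ i, ∀ᵐ x ∂μ.restrict Ω, hGrad X (fun x => a x * H i x ^ (1 - p x)) x =
      quotGrad X p a (H i) (fun x => c i x • hGrad X (φ i) x) x := by
    intro i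
    filter_upwards [hmem] with x hx
    exact hGrad_quotient hε (hη i) (ha.mdifferentiableAt one_ne_zero)
      ((hp.contMDiffAt (hΩ.mem_nhds hx)).mdifferentiableAt one_ne_zero)
      (IsTest.mdifferentiableAt (hφ i) x)
  have hindK : ∀ B : ℝ, MemVarLp μ Ω p (K.indicator fun _ => B) := fun B =>
    memVarLp_of_bounded hp1 (B := |B|) (measurable_const.indicator
      hK.measurableSet).aestronglyMeasurable hK.measurableSet hK.measure_lt_top
      (Eventually.of_forall fun x => by
        by_cases hx : x ∈ K <;> simp [hx])
  -- the coefficients of `h`, `H i` are bounded, and converge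
  have hEH : ∀ i, ∀ x ∈ Ω, _ := fun i x hx => hE (H i x) (p x) (hHε i x) (hpb x hx).1 (hpb x hx).2
  have hEh : ∀ᵐ x ∂μ.restrict Ω, |h x ^ (1 - p x)| ≤ E ∧ |h x ^ (-p x)| ≤ E ∧
      |h x ^ (1 - p x) * Real.log (h x)| ≤ E := by
    filter_upwards [hmem, hhε] with x hx hh
    exact hE (h x) (p x) hh (hpb x hx).1 (hpb x hx).2
  refine memW0_of_contMDiff_approx hp1 hpmeas hX hΩ
    (hma.mul (hmh.pow (hpmeas.const_sub 1))).aestronglyMeasurable (hmq hmh hv.1.2.1.1)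
    (fun i => (hψ1 i).1) (fun i => HasCompactSupport.of_support_subset_isCompact hK
      ((subset_tsupport _).trans (hψ1 i).2)) (fun i => (hψ1 i).2.trans haΩ) ?_ ?_
  · refine tendsto_modular_of_dominated hp1 hpmeas (fun i => ?_)
      (hindK (B₁ * (E + E))) (fun i => ?_) ?_
    · exact ((hma.mul (hmh.pow (hpmeas.const_sub 1))).sub
        (hma.mul ((hHc i).aemeasurable.pow (hpmeas.const_sub 1)))).aestronglyMeasurable
    · filter_upwards [hmem, hEh] with x hx hh
      rw [← mul_sub, norm_mul]
      by_cases hxK : x ∈ K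
      · have hb := hB₁ x
        simp only [Set.indicator_of_mem hxK] at hb ⊢
        exact mul_le_mul hb ((norm_sub_le _ _).trans (add_le_add hh.1 (hEH i x hx).1))
          (norm_nonneg _) hB₁0
      · simp [Set.indicator_of_notMem hxK, ha0 x hxK]
    · filter_upwards [hHlim, hhε] with x hx hh
      have h1 := (hx.rpow_const (p := 1 - p x) (Or.inl (hε.trans_le hh).ne')).const_mul (a x)
      simpa using (tendsto_const_nhds (x := a x * h x ^ (1 - p x))).sub h1
  -- split the difference of the gradients in a part to which dominated convergence applies
  -- and a bounded multiple of `w - ∇φ i`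
  let R : ℕ → M → EuclideanSpace ℝ (Fin N) := fun i x =>
    quotGrad X p a h w x - quotGrad X p a (H i) (fun x => c i x • w x) x
  let G : ℕ → M → EuclideanSpace ℝ (Fin N) := fun i x =>
    ((1 - p x) * a x * H i x ^ (-p x) * c i x) • (w x - hGrad X (φ i) x)
  have hsplit : ∀ i, ∀ᵐ x ∂μ.restrict Ω, quotGrad X p a h w x -
      hGrad X (fun x => a x * H i x ^ (1 - p x)) x = R i x + G i x := by
    intro i
    filter_upwards [hψg i] with x hx
    rw [hx]
    simp only [R, G, quotGrad, smul_sub, smul_smul]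
    abel
  have hpabs : ∀ x ∈ Ω, |1 - p x| ≤ pp := fun x hx => by
    have := hpb x hx
    rw [abs_le]
    constructor <;> linarith
  have hB₁' : ∀ x, |a x| ≤ B₁ := fun x => (hB₁ x).trans (Set.indicator_le_self' (fun _ _ => hB₁0) x)
  have hcoef : ∀ x ∈ Ω, ∀ y : ℝ, |y| ≤ E → |(1 - p x) * a x * y| ≤ pp * B₁ * E := by
    intro x hx y hy
    have h0 : 0 ≤ pp := (abs_nonneg _).trans (hpabs x hx)
    rw [abs_mul, abs_mul]
    exact mul_le_mul (mul_le_mul (hpabs x hx) (hB₁' x) (abs_nonneg _) h0) hy (abs_nonneg _)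
      (by positivity)
  have hRm : ∀ i, AEStronglyMeasurable (R i) (μ.restrict Ω) := fun i =>
    (hmq hmh hv.1.2.1.1).sub (hmq (hHc i).aemeasurable
      ((hcc i).aestronglyMeasurable.smul hv.1.2.1.1))
  have hRlim : Tendsto (fun i => modular μ Ω p (R i)) atTop (𝓝 0) := by
    set D := pp * B₁ * E with hD
    have hdom : MemVarLp μ Ω p (fun x => K.indicator (fun _ => (E + E) * B₂ + (E + E) * B₃) x +
        (D + D) * ‖w x‖) := by
      refine (hindK _).add hp1 hpmeas ⟨hv.1.2.1.1.norm.const_mul _, ?_⟩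
      have h1 : modular μ Ω p (fun x => (D + D) • w x) < ⊤ := by
        refine (modular_smul_le (D := (max |D + D| 1) ^ pp) ?_ (by positivity) _).trans_lt
          (ENNReal.mul_lt_top ENNReal.ofReal_lt_top hv.1.2.1.2)
        filter_upwards [hp1] with x hx
        exact (Real.rpow_le_rpow (abs_nonneg _) (le_max_left _ 1) (by linarith)).trans
          (Real.rpow_le_rpow_of_exponent_le (le_max_right _ _) hx.2)
      refine (modular_mono (hp1.mono fun x hx => by linarith [hx.1])
        (Eventually.of_forall fun x => ?_)).trans_lt h1
      simp [norm_smul]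
    refine tendsto_modular_of_dominated hp1 hpmeas hRm hdom (fun i => ?_) ?_
    · filter_upwards [hmem, hEh] with x hx hh
      have hH := hEH i x hx
      have e : R i x = (h x ^ (1 - p x) - H i x ^ (1 - p x)) • hGrad X a x -
          (h x ^ (1 - p x) * Real.log (h x) - H i x ^ (1 - p x) * Real.log (H i x)) •
            (a x • hGrad X p x) +
          ((1 - p x) * a x * h x ^ (-p x) - (1 - p x) * a x * (H i x ^ (-p x) * c i x)) • w x := by
        simp only [R, quotGrad]
        module
      have hHc1 : |H i x ^ (-p x) * c i x| ≤ E := by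
        rw [abs_mul]
        exact (mul_le_mul hH.2.1 (hc1 i x) (abs_nonneg _) hE0).trans (mul_one E).le
      have hE2 : ∀ {y z : ℝ}, |y| ≤ E → |z| ≤ E → ‖y - z‖ ≤ E + E := fun hy hz =>
        (norm_sub_le _ _).trans (add_le_add hy hz)
      have t1 : ‖(h x ^ (1 - p x) - H i x ^ (1 - p x)) • hGrad X a x‖ ≤
          K.indicator (fun _ => (E + E) * B₂) x := by
        rw [norm_smul]
        refine (mul_le_mul (hE2 hh.1 hH.1) (hB₂ x) (norm_nonneg _) (by positivity)).trans ?_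
        by_cases hxK : x ∈ K <;> simp [hxK]
      have t2 : ‖(h x ^ (1 - p x) * Real.log (h x) - H i x ^ (1 - p x) * Real.log (H i x)) •
            (a x • hGrad X p x)‖ ≤ K.indicator (fun _ => (E + E) * B₃) x := by
        rw [norm_smul]
        refine (mul_le_mul (hE2 hh.2.2 hH.2.2) (hB₃ x) (norm_nonneg _) (by positivity)).trans ?_
        by_cases hxK : x ∈ K <;> simp [hxK]
      have t3 : ‖((1 - p x) * a x * h x ^ (-p x) -
          (1 - p x) * a x * (H i x ^ (-p x) * c i x)) • w x‖ ≤ (D + D) * ‖w x‖ := by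
        rw [norm_smul]
        refine mul_le_mul_of_nonneg_right ?_ (norm_nonneg _)
        exact (norm_sub_le _ _).trans (add_le_add (hcoef x hx _ hh.2.1) (hcoef x hx _ hHc1))
      rw [e]
      refine (norm_add_le _ _).trans (add_le_add ((norm_sub_le _ _).trans
        ((add_le_add t1 t2).trans ?_)) t3)
      by_cases hxK : x ∈ K <;> simp [hxK]
    · filter_upwards [hHlim, hclim, hhε] with x hx hcx hh
      have hx0 : h x ≠ 0 := (hε.trans_le hh).ne'
      have l1 := hx.rpow_const (p := 1 - p x) (Or.inl hx0)
      have l2 := hx.rpow_const (p := -p x) (Or.inl hx0)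
      have l3 := hx.log hx0
      have l4 : Tendsto (fun i => quotGrad X p a (H i) (fun x => c i x • w x) x) atTop
          (𝓝 (quotGrad X p a h (fun x => (1 : ℝ) • w x) x)) :=
        ((l1.smul_const _).sub (((l1.mul l3).const_mul (a x)).smul_const _)).add
          ((l2.const_mul ((1 - p x) * a x)).smul (hcx.smul_const (w x)))
      simp only [one_smul] at l4
      simpa [R] using (tendsto_const_nhds (x := quotGrad X p a h w x)).sub l4
  have hGlim : Tendsto (fun i => modular μ Ω p (G i)) atTop (𝓝 0) := by
    set D := pp * B₁ * E with hD
    have h1 : Tendsto (fun i => ENNReal.ofReal ((max |D| 1) ^ pp) *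
        modular μ Ω p (fun x => w x - hGrad X (φ i) x)) atTop (𝓝 0) := by
      simpa using ENNReal.Tendsto.const_mul hφw (Or.inr ENNReal.ofReal_ne_top)
    refine tendsto_of_tendsto_of_tendsto_of_le_of_le tendsto_const_nhds h1 (fun _ => zero_le)
      fun i => ?_
    refine le_trans (modular_mono (g := fun x => D • (w x - hGrad X (φ i) x))
      (hp1.mono fun x hx => by linarith [hx.1]) ?_) (modular_smul_le ?_ (by positivity) _)
    · filter_upwards [hmem] with x hx
      simp only [G]
      rw [norm_smul, norm_smul]
      refine mul_le_mul_of_nonneg_right ?_ (norm_nonneg _)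
      refine le_trans ?_ (le_abs_self D)
      rw [mul_assoc]
      refine hcoef x hx _ ?_
      rw [abs_mul]
      exact (mul_le_mul (hEH i x hx).2.1 (hc1 i x) (abs_nonneg _) hE0).trans (mul_one E).le
    · filter_upwards [hp1] with x hx
      exact (Real.rpow_le_rpow (abs_nonneg _) (le_max_left _ 1) (by linarith)).trans
        (Real.rpow_le_rpow_of_exponent_le (le_max_right _ _) hx.2)
  have hsum : Tendsto (fun i => ENNReal.ofReal (2 ^ pp) *
      (modular μ Ω p (R i) + modular μ Ω p (G i))) atTop (𝓝 0) := by
    simpa using ENNReal.Tendsto.const_mul (hRlim.add hGlim) (Or.inr ENNReal.ofReal_ne_top)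
  refine tendsto_of_tendsto_of_tendsto_of_le_of_le tendsto_const_nhds hsum (fun _ => zero_le)
    fun i => ?_
  refine le_trans (modular_mono (hp1.mono fun x hx => by linarith [hx.1]) ?_)
    (modular_add_le hp1 hpmeas (hRm i))
  filter_upwards [hsplit i] with x hx
  rw [hx]

end QuotientSobolev

/-! ### The Picone inequality -/

section Picone

/-- Young's inequality in the form `q x^{q-1} y ≤ (q-1) x^q + y^q`. -/
lemma mul_rpow_sub_one_mul_le {x y q : ℝ} (hx : 0 ≤ x) (hy : 0 ≤ y) (hq : 1 < q) :
    q * (x ^ (q - 1) * y) ≤ (q - 1) * x ^ q + y ^ q := by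
  have hconj : (q / (q - 1)).HolderConjugate q := (Real.HolderConjugate.conjExponent hq).symm
  have h := Real.young_inequality_of_nonneg (Real.rpow_nonneg hx (q - 1)) hy hconj
  have hq1 : q - 1 ≠ 0 := by linarith
  have hq0 : q ≠ 0 := by linarith
  rw [← Real.rpow_mul hx, mul_div_cancel₀ _ hq1] at h
  calc q * (x ^ (q - 1) * y) ≤ q * (x ^ q / (q / (q - 1)) + y ^ q / q) := by gcongr
    _ = _ := by field_simp

lemma rpow_sub_two_mul_sq {a q : ℝ} (ha : 0 ≤ a) (hq : 0 < q) : a ^ (q - 2) * a ^ 2 = a ^ q := by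
  rcases ha.eq_or_lt with rfl | ha0
  · rw [Real.zero_rpow hq.ne']
    simp
  · rw [← Real.rpow_natCast, ← Real.rpow_add ha0]
    congr 1
    push_cast
    ring

/-- The pointwise inequality of Picone type: `w` is the gradient of `h`, `f` the gradient of `s`,
and `P` the gradient of the exponent. The regularization `d > 0` of the power of `s` costs the last
term. -/
lemma picone_inequality {E : Type*} [NormedAddCommGroup E] [InnerProductSpace ℝ E]
    {w f P : E} (hP : inner ℝ P w = 0) {q s d h b c : ℝ} (hq : 1 < q) (hd : 0 < d) (hh : 0 < h) :
    ‖w‖ ^ (q - 2) * inner ℝ w (h ^ (1 - q) • ((q * s * (s ^ 2 + d) ^ (q / 2 - 1)) • f + b • P) -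
      c • P + ((1 - q) * ((s ^ 2 + d) ^ (q / 2) - d ^ (q / 2)) * h ^ (-q)) • w) ≤
    ‖f‖ ^ q + (q - 1) * (d ^ (q / 2) * h ^ (-q)) * ‖w‖ ^ q := by
  have hP' : inner ℝ w P = 0 := by rw [real_inner_comm]; exact hP
  rcases eq_or_ne w 0 with rfl | hw
  · simp only [inner_zero_left, mul_zero]
    have : 0 ≤ q - 1 := by linarith
    positivity
  have hw0 : 0 < ‖w‖ := norm_pos_iff.2 hw
  set S := s ^ 2 + d with hS
  have hS0 : 0 < S := by positivity
  have e1 : ‖w‖ ^ (q - 2) * ‖w‖ ^ 2 = ‖w‖ ^ q :=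
    rpow_sub_two_mul_sq hw0.le (by linarith)
  have e2 : ‖w‖ ^ (q - 2) * ‖w‖ = ‖w‖ ^ (q - 1) := by
    nth_rw 2 [← Real.rpow_one ‖w‖]
    rw [← Real.rpow_add hw0]
    congr 1
    ring
  have e3 : √S * S ^ (q / 2 - 1) = √S ^ (q - 1) := by
    rw [Real.sqrt_eq_rpow, ← Real.rpow_add hS0, ← Real.rpow_mul hS0.le]
    congr 1
    ring
  have hx1 : (√S / h * ‖w‖) ^ (q - 1) = √S ^ (q - 1) * h ^ (1 - q) * ‖w‖ ^ (q - 1) := by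
    rw [Real.mul_rpow (by positivity) hw0.le, Real.div_rpow (Real.sqrt_nonneg _) hh.le,
      div_eq_mul_inv, ← Real.rpow_neg hh.le, neg_sub]
  have hx2 : (√S / h * ‖w‖) ^ q = S ^ (q / 2) * h ^ (-q) * ‖w‖ ^ q := by
    rw [Real.mul_rpow (by positivity) hw0.le, Real.div_rpow (Real.sqrt_nonneg _) hh.le,
      div_eq_mul_inv, ← Real.rpow_neg hh.le, Real.sqrt_eq_rpow, ← Real.rpow_mul hS0.le]
    congr 3
    ring
  have hs : |s| ≤ √S := Real.abs_le_sqrt (by linarith)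
  have hsf : s * inner ℝ w f ≤ √S * (‖w‖ * ‖f‖) :=
    (le_abs_self _).trans ((abs_mul _ _).trans_le
      (mul_le_mul hs (abs_real_inner_le_norm w f) (abs_nonneg _) (Real.sqrt_nonneg _)))
  have hyoung := mul_rpow_sub_one_mul_le (x := √S / h * ‖w‖) (y := ‖f‖) (by positivity)
    (norm_nonneg f) hq
  rw [hx1, hx2] at hyoung
  simp only [inner_add_right, inner_sub_right, inner_smul_right, hP', real_inner_self_eq_norm_sq]
  have main : ‖w‖ ^ (q - 2) * (h ^ (1 - q) * (q * s * S ^ (q / 2 - 1) * inner ℝ w f)) ≤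
      q * (√S ^ (q - 1) * h ^ (1 - q) * ‖w‖ ^ (q - 1) * ‖f‖) := by
    calc ‖w‖ ^ (q - 2) * (h ^ (1 - q) * (q * s * S ^ (q / 2 - 1) * inner ℝ w f))
        = ‖w‖ ^ (q - 2) * h ^ (1 - q) * q * S ^ (q / 2 - 1) * (s * inner ℝ w f) := by ring
      _ ≤ ‖w‖ ^ (q - 2) * h ^ (1 - q) * q * S ^ (q / 2 - 1) * (√S * (‖w‖ * ‖f‖)) :=
          mul_le_mul_of_nonneg_left hsf (by positivity)
      _ = q * ((√S * S ^ (q / 2 - 1)) * h ^ (1 - q) * (‖w‖ ^ (q - 2) * ‖w‖) * ‖f‖) := by ring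
      _ = _ := by rw [e2, e3]
  have e4 : ‖w‖ ^ (q - 2) * ((1 - q) * (S ^ (q / 2) - d ^ (q / 2)) * h ^ (-q) * ‖w‖ ^ 2) =
      (1 - q) * (S ^ (q / 2) - d ^ (q / 2)) * h ^ (-q) * ‖w‖ ^ q := by
    rw [← e1]; ring
  calc _ = ‖w‖ ^ (q - 2) * (h ^ (1 - q) * (q * s * S ^ (q / 2 - 1) * inner ℝ w f)) +
        ‖w‖ ^ (q - 2) * ((1 - q) * (S ^ (q / 2) - d ^ (q / 2)) * h ^ (-q) * ‖w‖ ^ 2) := by ring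
    _ ≤ _ := by rw [e4]; linarith

lemma norm_rpow_mul_inner_le {E : Type*} [NormedAddCommGroup E] [InnerProductSpace ℝ E]
    {w z : E} {q : ℝ} (hq : 1 < q) : |‖w‖ ^ (q - 2) * inner ℝ w z| ≤ ‖w‖ ^ q + ‖z‖ ^ q := by
  rcases eq_or_ne w 0 with rfl | hw
  · simp only [inner_zero_left, mul_zero, abs_zero]
    positivity
  have hw0 : 0 < ‖w‖ := norm_pos_iff.2 hw
  have e : ‖w‖ ^ (q - 2) * ‖w‖ = ‖w‖ ^ (q - 1) := by
    nth_rw 2 [← Real.rpow_one ‖w‖]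
    rw [← Real.rpow_add hw0]
    congr 1
    ring
  have hle : |‖w‖ ^ (q - 2) * inner ℝ w z| ≤ ‖w‖ ^ (q - 1) * ‖z‖ := by
    rw [abs_mul, abs_of_nonneg (by positivity : 0 ≤ ‖w‖ ^ (q - 2)), ← e, mul_assoc]
    exact mul_le_mul_of_nonneg_left (abs_real_inner_le_norm w z) (by positivity)
  have hy := mul_rpow_sub_one_mul_le hw0.le (norm_nonneg z) hq
  have h1 : 0 ≤ ‖w‖ ^ (q - 1) * ‖z‖ := by positivity
  have h2 : 0 ≤ ‖w‖ ^ q := by positivity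
  have h3 : 0 ≤ ‖z‖ ^ q := by positivity
  refine hle.trans (le_of_mul_le_mul_left ?_ (by linarith : 0 < q))
  nlinarith

/-- Differential of `(φ² + d)^{p/2} - d^{p/2}`. Only the coefficient of `dφ` matters later, since
`∇_X p` is orthogonal to the gradient of the sup-solution. -/
lemma hasFDerivAt_regPow {E : Type*} [NormedAddCommGroup E] [NormedSpace ℝ E]
    {φ p : E → ℝ} {φ' p' : E →L[ℝ] ℝ} {y : E} {d : ℝ} (hd : 0 < d)
    (hφ : HasFDerivAt φ φ' y) (hp : HasFDerivAt p p' y) :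
    HasFDerivAt (fun z => (φ z ^ 2 + d) ^ (p z / 2) - d ^ (p z / 2))
      ((p y * φ y * (φ y ^ 2 + d) ^ (p y / 2 - 1)) • φ' +
        (((φ y ^ 2 + d) ^ (p y / 2) * Real.log (φ y ^ 2 + d) -
          d ^ (p y / 2) * Real.log d) / 2) • p') y := by
  have hS : 0 < φ y ^ 2 + d := by positivity
  have h1 := (((hφ.pow 2).add_const d).rpow (hp.mul_const (2⁻¹ : ℝ)) hS).sub
    ((hp.mul_const (2⁻¹ : ℝ)).const_rpow hd)
  simp only [← div_eq_mul_inv] at h1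
  refine h1.congr_fderiv ?_
  ext z
  simp
  ring

variable {n N : ℕ} {M : Type*} [TopologicalSpace M]
  [ChartedSpace (EuclideanSpace ℝ (Fin n)) M]
  {X : Fin N → (x : M) → TangentSpace (𝓡 n) x} {Ω : Set M} {p : M → ℝ}

/-- The regularization `(φ² + d)^{p/2} - d^{p/2}` of `|φ|^p`, for `d > 0`: it is as smooth as `p`,
and vanishes where `φ` does. -/
noncomputable def regPow {M : Type*} (p φ : M → ℝ) (d : ℝ) (x : M) : ℝ :=
  (φ x ^ 2 + d) ^ (p x / 2) - d ^ (p x / 2)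

lemma regPow_eq_zero {M : Type*} {p φ : M → ℝ} {d : ℝ} {x : M} (h : φ x = 0) :
    regPow p φ d x = 0 := by
  simp [regPow, h]

lemma regPow_nonneg {M : Type*} {p φ : M → ℝ} {d : ℝ} {x : M} (hd : 0 ≤ d) (hp : 0 ≤ p x) :
    0 ≤ regPow p φ d x :=
  sub_nonneg.2 (Real.rpow_le_rpow hd (le_add_of_nonneg_left (sq_nonneg _)) (by linarith))

lemma hGrad_regPow {φ : M → ℝ} {x : M} {d : ℝ} (hd : 0 < d)
    (hφ : MDifferentiableAt (𝓡 n) 𝓘(ℝ, ℝ) φ x) (hp : MDifferentiableAt (𝓡 n) 𝓘(ℝ, ℝ) p x) :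
    hGrad X (regPow p φ d) x =
      (p x * φ x * (φ x ^ 2 + d) ^ (p x / 2 - 1)) • hGrad X φ x +
        (((φ x ^ 2 + d) ^ (p x / 2) * Real.log (φ x ^ 2 + d) -
          d ^ (p x / 2) * Real.log d) / 2) • hGrad X p x := by
  obtain ⟨Lφ, hLφ⟩ := hasFDerivAt_chart hφ
  obtain ⟨Lp, hLp⟩ := hasFDerivAt_chart hp
  have hS : φ x ^ 2 + d ≠ 0 := by positivity
  have hp2 : ContinuousAt (fun x => p x / 2) x := hp.continuousAt.div_const 2
  have hcont : ContinuousAt (regPow p φ d) x :=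
    (((hφ.continuousAt.pow 2).add continuousAt_const).rpow hp2 (Or.inl hS)).sub
      (continuousAt_const.rpow hp2 (Or.inl hd.ne'))
  ext k
  refine (hGrad_apply_of_hasFDerivAt hcont (hasFDerivAt_regPow hd hLφ hLp) k).trans ?_
  simp only [PiLp.add_apply, PiLp.smul_apply, hGrad_apply_of_hasFDerivAt hφ.continuousAt hLφ,
    hGrad_apply_of_hasFDerivAt hp.continuousAt hLp]
  simp
  rfl

lemma contMDiffOn_regPow {φ : M → ℝ} {d : ℝ} (hd : 0 < d)
    (hφ : ContMDiffOn (𝓡 n) 𝓘(ℝ, ℝ) 1 φ Ω) (hp : ContMDiffOn (𝓡 n) 𝓘(ℝ, ℝ) 1 p Ω) :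
    ContMDiffOn (𝓡 n) 𝓘(ℝ, ℝ) 1 (regPow p φ d) Ω := by
  have hG : ContDiff ℝ 1 (fun y : ℝ × ℝ => (y.1 ^ 2 + d) ^ (y.2 / 2) - d ^ (y.2 / 2)) := by
    have h2 : ContDiff ℝ 1 (fun y : ℝ × ℝ => y.2 / 2) := contDiff_snd.div_const 2
    exact (((contDiff_fst.pow 2).add contDiff_const).rpow h2 fun y => by positivity).sub
      (contDiff_const.rpow h2 fun y => hd.ne')
  exact hG.contMDiff.comp_contMDiffOn (hφ.prodMk_space hp)

end Picone

/-! ### The integral inequality -/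

section Weighted

variable {M : Type*} [MeasurableSpace M] {F : Type*} [NormedAddCommGroup F]
  {μ : Measure M} {Ω : Set M} {p g : M → ℝ} {pp C : ℝ}

lemma MemVarLp.integrable_weight (hpm : AEMeasurable p (μ.restrict Ω))
    (hgm : AEMeasurable g (μ.restrict Ω)) (hg : ∀ᵐ x ∂μ.restrict Ω, 0 ≤ g x ∧ g x ≤ C)
    {f : M → F} (hf : MemVarLp μ Ω p f) :
    Integrable (fun x => g x * ‖f x‖ ^ p x) (μ.restrict Ω) := by
  refine ((hf.integrable hpm).const_mul C).mono'
    (hgm.mul (aemeasurable_norm_rpow hpm hf.1)).aestronglyMeasurable ?_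
  filter_upwards [hg] with x hx
  rw [Real.norm_of_nonneg (mul_nonneg hx.1 (by positivity))]
  exact mul_le_mul_of_nonneg_right hx.2 (by positivity)

/-- Continuity estimate for the weighted modular. -/
lemma integral_weight_add_le (hp : ∀ᵐ x ∂μ.restrict Ω, 1 ≤ p x ∧ p x ≤ pp)
    (hpm : AEMeasurable p (μ.restrict Ω)) (hgm : AEMeasurable g (μ.restrict Ω))
    (hg : ∀ᵐ x ∂μ.restrict Ω, 0 ≤ g x ∧ g x ≤ C) {f e : M → F} (hf : MemVarLp μ Ω p f)
    (he : MemVarLp μ Ω p e) {t : ℝ} (ht : 0 < t) (ht1 : t < 1) :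
    ∫ x in Ω, g x * ‖f x + e x‖ ^ p x ∂μ ≤
      (1 - t) ^ (1 - pp) * ∫ x in Ω, g x * ‖f x‖ ^ p x ∂μ +
        t ^ (1 - pp) * C * (modular μ Ω p e).toReal := by
  rw [← he.integral_eq hpm, ← integral_const_mul, ← integral_const_mul, ← integral_add]
  · refine integral_mono_ae ((hf.add hp hpm he).integrable_weight hpm hgm hg) ?_ ?_
    · exact ((hf.integrable_weight hpm hgm hg).const_mul _).add
        ((he.integrable hpm).const_mul _)
    · filter_upwards [hp, hg] with x hx hgx
      have hs : 0 < 1 - t := by linarith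
      have h1 : ‖f x + e x‖ ^ p x ≤
          (1 - t) ^ (1 - pp) * ‖f x‖ ^ p x + t ^ (1 - pp) * ‖e x‖ ^ p x :=
        (Real.rpow_le_rpow (norm_nonneg _) (norm_add_le _ _) (by linarith)).trans
          (add_rpow_le (norm_nonneg _) (norm_nonneg _) ht ht1 hx.1 hx.2)
      calc g x * ‖f x + e x‖ ^ p x
          ≤ g x * ((1 - t) ^ (1 - pp) * ‖f x‖ ^ p x + t ^ (1 - pp) * ‖e x‖ ^ p x) :=
            mul_le_mul_of_nonneg_left h1 hgx.1
        _ = (1 - t) ^ (1 - pp) * (g x * ‖f x‖ ^ p x) + g x * (t ^ (1 - pp) * ‖e x‖ ^ p x) := by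
            ring
        _ ≤ (1 - t) ^ (1 - pp) * (g x * ‖f x‖ ^ p x) + C * (t ^ (1 - pp) * ‖e x‖ ^ p x) := by
            gcongr
            exact hgx.2
        _ = _ := by ring
  · exact (hf.integrable_weight hpm hgm hg).const_mul _
  · exact (he.integrable hpm).const_mul _

/-- The denominator of the Rayleigh quotient does not vanish at nonzero functions. -/
lemma integral_weight_pos (hp : ∀ᵐ x ∂μ.restrict Ω, 1 ≤ p x ∧ p x ≤ pp)
    (hpm : AEMeasurable p (μ.restrict Ω))
    (hgm : AEMeasurable g (μ.restrict Ω)) (hg : ∀ᵐ x ∂μ.restrict Ω, 0 < g x ∧ g x ≤ C)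
    {u : M → ℝ} (hu : MemVarLp μ Ω p u) (hu0 : ¬ u =ᵐ[μ.restrict Ω] 0) :
    0 < ∫ x in Ω, g x * ‖u x‖ ^ p x ∂μ := by
  have hnn : 0 ≤ᵐ[μ.restrict Ω] fun x => g x * ‖u x‖ ^ p x := by
    filter_upwards [hg] with x hx
    exact mul_nonneg hx.1.le (by positivity)
  refine lt_of_le_of_ne (integral_nonneg_of_ae hnn) fun h0 => hu0 ?_
  have h1 := (integral_eq_zero_iff_of_nonneg_ae hnn (hu.integrable_weight hpm hgm
    (hg.mono fun x hx => ⟨hx.1.le, hx.2⟩))).1 h0.symm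
  filter_upwards [h1, hg, hp] with x hx hgx hpx
  have h2 : ‖u x‖ ^ p x = 0 := (mul_eq_zero.1 hx).resolve_left hgx.1.ne'
  simpa using ((Real.rpow_eq_zero_iff_of_nonneg (norm_nonneg _)).1 h2).1

end Weighted

section Inequality

variable {n N : ℕ} {M : Type*} [TopologicalSpace M] [T2Space M]
  [ChartedSpace (EuclideanSpace ℝ (Fin n)) M] [IsManifold (𝓡 n) ∞ M]
  [MeasurableSpace M] [BorelSpace M] {μ : Measure M}
  {X : Fin N → (x : M) → TangentSpace (𝓡 n) x} {Ω : Set M} {p g : M → ℝ} {pm pp C lam : ℝ}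

/-- The inequality obtained by inserting the quotient test function in the weak inequality, with
regularization parameters `ε` for `v` and `ε⁴` for `|φ|^p`. -/
lemma IsSupSolution.integral_le [SecondCountableTopology M]
    [IsLocallyFiniteMeasure μ] (hX : SmoothFields X) (hΩ : IsOpen Ω)
    (hp : ContMDiffOn (𝓡 n) 𝓘(ℝ, ℝ) 1 p Ω) (hpm : 1 < pm)
    (hpb : ∀ x ∈ Ω, pm ≤ p x ∧ p x ≤ pp)
    {v : M → ℝ} {w : M → EuclideanSpace ℝ (Fin N)} (hv : IsSupSolution μ X Ω p g lam v w)
    (hvpos : ∀ᵐ x ∂μ.restrict Ω, 0 < v x)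
    (horth : ∀ᵐ x ∂μ.restrict Ω, inner ℝ (hGrad X p x) (w x) = 0)
    {φ : M → ℝ} (hφ : IsTest n Ω φ) {ε : ℝ} (hε : 0 < ε) (hε1 : ε ≤ 1) :
    lam * ∫ x in Ω, g x * |v x| ^ (p x - 2) * v x *
        (regPow p φ (ε ^ 4) x * (v x + ε) ^ (1 - p x)) ∂μ ≤
      (∫ x in Ω, ‖hGrad X φ x‖ ^ p x ∂μ) + pp * ε * ∫ x in Ω, ‖w x‖ ^ p x ∂μ := by
  have hmem : ∀ᵐ x ∂μ.restrict Ω, x ∈ Ω := ae_restrict_mem hΩ.measurableSet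
  have hp1 : ∀ᵐ x ∂μ.restrict Ω, 1 ≤ p x ∧ p x ≤ pp := by
    filter_upwards [hmem] with x hx
    exact ⟨hpm.le.trans (hpb x hx).1, (hpb x hx).2⟩
  have hpmeas : AEMeasurable p (μ.restrict Ω) := hp.continuousOn.aemeasurable hΩ.measurableSet
  have hd : 0 < ε ^ 4 := by positivity
  have hts : tsupport (regPow p φ (ε ^ 4)) ⊆ tsupport φ :=
    closure_mono fun x hx h => hx (regPow_eq_zero h)
  have ha : ContMDiff (𝓡 n) 𝓘(ℝ, ℝ) 1 (regPow p φ (ε ^ 4)) :=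
    contMDiff_of_isOpen_tsupport hΩ (contMDiffOn_regPow hd hφ.contMDiff_one.contMDiffOn hp)
      (hts.trans hφ.2.2)
  have hac : HasCompactSupport (regPow p φ (ε ^ 4)) :=
    hφ.2.1.mono' ((subset_tsupport _).trans hts)
  have hψ := memW0_quotient hX hΩ hp hpm hpb hv.1 hvpos ha hac (hts.trans hφ.2.2) hε hε1
  have hform := hv.2 _ _ hψ (by
    filter_upwards [hmem, hvpos] with x hx hvx
    exact mul_nonneg (regPow_nonneg hd.le (by linarith [(hpb x hx).1]))
      (Real.rpow_nonneg (by linarith) _))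
  rw [weakForm, sub_nonneg] at hform
  refine hform.trans ?_
  have hw := hv.1.1.2.1
  have hwi := hw.integrable hpmeas
  have hφi := (hφ.memVarLp_hGrad hp1 hX).integrable hpmeas
  rw [← integral_const_mul, ← integral_add hφi (hwi.const_mul _)]
  refine integral_mono_ae ?_ (hφi.add (hwi.const_mul _)) ?_
  · refine (hwi.add (hψ.1.2.1.integrable hpmeas)).mono' ?_ ?_
    · exact ((hw.1.norm.aemeasurable.pow (hpmeas.sub_const 2)).aestronglyMeasurable).mul
        (hw.1.inner hψ.1.2.1.1)
    · filter_upwards [hmem] with x hx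
      exact norm_rpow_mul_inner_le (hpm.trans_le (hpb x hx).1)
  · filter_upwards [hmem, hvpos, horth] with x hx hvx hox
    obtain ⟨hq1, hq2⟩ := hpb x hx
    have hq : 1 < p x := hpm.trans_le hq1
    have hh : 0 < v x + ε := by linarith
    have hpic := picone_inequality (w := w x) (f := hGrad X φ x) (P := hGrad X p x) hox
      (s := φ x) (h := v x + ε) (b := ((φ x ^ 2 + ε ^ 4) ^ (p x / 2) * Real.log (φ x ^ 2 + ε ^ 4) -
          (ε ^ 4) ^ (p x / 2) * Real.log (ε ^ 4)) / 2)
      (c := regPow p φ (ε ^ 4) x * ((v x + ε) ^ (1 - p x) * Real.log (v x + ε))) hq hd hh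
    rw [← hGrad_regPow hd (IsTest.mdifferentiableAt hφ x)
      ((hp.contMDiffAt (hΩ.mem_nhds hx)).mdifferentiableAt one_ne_zero)] at hpic
    refine le_trans hpic (add_le_add le_rfl ?_)
    refine mul_le_mul_of_nonneg_right ?_ (by positivity)
    -- the regularization error: `d^{p/2} h^{-p} ≤ ε^{2p} ε^{-p} = ε^p ≤ ε`
    have e1 : (ε ^ 4) ^ (p x / 2) * (v x + ε) ^ (-p x) ≤ ε := by
      calc (ε ^ 4) ^ (p x / 2) * (v x + ε) ^ (-p x)
          ≤ (ε ^ 4) ^ (p x / 2) * ε ^ (-p x) :=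
            mul_le_mul_of_nonneg_left
              (Real.rpow_le_rpow_of_nonpos hε (by linarith) (by linarith)) (by positivity)
        _ = ε ^ p x := by
            rw [← Real.rpow_natCast, ← Real.rpow_mul hε.le, ← Real.rpow_add hε]
            congr 1
            push_cast
            ring
        _ ≤ ε ^ (1 : ℝ) := Real.rpow_le_rpow_of_exponent_ge hε hε1 hq.le
        _ = ε := Real.rpow_one ε
    exact mul_le_mul (by linarith) e1 (by positivity) (by linarith)

/-- The inequality for test functions, by letting the regularization parameter tend to `0`. -/
lemma IsSupSolution.le_of_isTest [SecondCountableTopology M]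
    [IsLocallyFiniteMeasure μ] (hX : SmoothFields X) (hΩ : IsOpen Ω)
    (hp : ContMDiffOn (𝓡 n) 𝓘(ℝ, ℝ) 1 p Ω) (hpm : 1 < pm)
    (hpb : ∀ x ∈ Ω, pm ≤ p x ∧ p x ≤ pp)
    (hgm : AEMeasurable g (μ.restrict Ω)) (hg : ∀ᵐ x ∂μ.restrict Ω, 0 ≤ g x ∧ g x ≤ C)
    {v : M → ℝ} {w : M → EuclideanSpace ℝ (Fin N)} (hv : IsSupSolution μ X Ω p g lam v w)
    (hvpos : ∀ᵐ x ∂μ.restrict Ω, 0 < v x)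
    (horth : ∀ᵐ x ∂μ.restrict Ω, inner ℝ (hGrad X p x) (w x) = 0)
    {φ : M → ℝ} (hφ : IsTest n Ω φ) :
    lam * ∫ x in Ω, g x * ‖φ x‖ ^ p x ∂μ ≤ ∫ x in Ω, ‖hGrad X φ x‖ ^ p x ∂μ := by
  have hmem : ∀ᵐ x ∂μ.restrict Ω, x ∈ Ω := ae_restrict_mem hΩ.measurableSet
  have hp1 : ∀ᵐ x ∂μ.restrict Ω, 1 ≤ p x ∧ p x ≤ pp := by
    filter_upwards [hmem] with x hx
    exact ⟨hpm.le.trans (hpb x hx).1, (hpb x hx).2⟩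
  have hpmeas : AEMeasurable p (μ.restrict Ω) := hp.continuousOn.aemeasurable hΩ.measurableSet
  let ε : ℕ → ℝ := fun i => 1 / ((i : ℝ) + 1)
  have hε : ∀ i, 0 < ε i := fun i => Nat.one_div_pos_of_nat
  have hε1 : ∀ i, ε i ≤ 1 := fun i => by
    rw [div_le_one (by positivity)]
    linarith [(Nat.cast_nonneg i : (0 : ℝ) ≤ i)]
  have hεlim : Tendsto ε atTop (𝓝 0) := tendsto_one_div_add_atTop_nhds_zero_nat
  have hε4 : Tendsto (fun i => ε i ^ 4) atTop (𝓝 0) := by simpa using hεlim.pow 4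
  obtain ⟨B, hB0, hB⟩ := exists_indicator_bound hφ.2.1.isCompact hφ.continuous.continuousOn
    fun _ hx => image_eq_zero_of_notMem_tsupport hx
  have hK := hφ.2.1.isCompact
  have hmv : AEMeasurable v (μ.restrict Ω) := hv.1.1.1.1.aemeasurable
  have hmφ : AEMeasurable φ (μ.restrict Ω) := hφ.continuous.aemeasurable
  have hlim : Tendsto (fun i => ∫ x in Ω, g x * |v x| ^ (p x - 2) * v x *
      (regPow p φ (ε i ^ 4) x * (v x + ε i) ^ (1 - p x)) ∂μ) atTop
      (𝓝 (∫ x in Ω, g x * ‖φ x‖ ^ p x ∂μ)) := by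
    refine tendsto_integral_of_dominated_convergence
      ((tsupport φ).indicator fun _ => |C| * (B ^ 2 + 1) ^ pp) (fun i => ?_) ?_ (fun i => ?_) ?_
    · have hmr : AEMeasurable (regPow p φ (ε i ^ 4)) (μ.restrict Ω) :=
        (((hmφ.pow_const 2).add_const _).pow (hpmeas.div_const 2)).sub
          (aemeasurable_const.pow (hpmeas.div_const 2))
      exact (((hgm.mul (hmv.abs.pow (hpmeas.sub_const 2))).mul hmv).mul
        (hmr.mul ((hmv.add_const _).pow (hpmeas.const_sub 1)))).aestronglyMeasurable
    · exact ((integrable_indicator_iff hK.measurableSet).2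
        (integrableOn_const hK.measure_lt_top.ne)).restrict
    · filter_upwards [hmem, hvpos, hg] with x hx hvx hgx
      obtain ⟨hq1, hq2⟩ := hpb x hx
      by_cases hxK : x ∈ tsupport φ
      · have hb := hB x
        rw [Set.indicator_of_mem hxK] at hb ⊢
        have e1 : |v x| ^ (p x - 2) * v x = v x ^ (p x - 1) := by
          rw [abs_of_pos hvx]
          nth_rw 2 [← Real.rpow_one (v x)]
          rw [← Real.rpow_add hvx]
          congr 1
          ring
        have e2 : v x ^ (p x - 1) * (v x + ε i) ^ (1 - p x) ≤ 1 := by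
          rw [show 1 - p x = -(p x - 1) by ring, Real.rpow_neg (by linarith [hε i]),
            ← div_eq_mul_inv]
          refine div_le_one_of_le₀ (Real.rpow_le_rpow hvx.le (by linarith [hε i]) (by linarith)) ?_
          exact Real.rpow_nonneg (by linarith [hε i]) _
        have hr0 : 0 ≤ regPow p φ (ε i ^ 4) x :=
          regPow_nonneg (pow_nonneg (hε i).le 4) (by linarith)
        have hr1 : regPow p φ (ε i ^ 4) x ≤ (B ^ 2 + 1) ^ pp := by
          have hb2 : φ x ^ 2 ≤ B ^ 2 := by
            rw [← sq_abs]
            exact pow_le_pow_left₀ (abs_nonneg _) hb 2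
          have hε41 : ε i ^ 4 ≤ 1 := pow_le_one₀ (hε i).le (hε1 i)
          have hε40 : 0 ≤ ε i ^ 4 := pow_nonneg (hε i).le 4
          calc regPow p φ (ε i ^ 4) x ≤ (φ x ^ 2 + ε i ^ 4) ^ (p x / 2) :=
                sub_le_self _ (by positivity)
            _ ≤ (B ^ 2 + 1) ^ (p x / 2) :=
                Real.rpow_le_rpow (by positivity) (by linarith) (by linarith)
            _ ≤ (B ^ 2 + 1) ^ pp :=
                Real.rpow_le_rpow_of_exponent_le (by linarith [sq_nonneg B]) (by linarith)
        have h0 : 0 ≤ v x ^ (p x - 1) * (v x + ε i) ^ (1 - p x) :=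
          mul_nonneg (Real.rpow_nonneg hvx.le _) (Real.rpow_nonneg (by linarith [hε i]) _)
        have e3 : g x * |v x| ^ (p x - 2) * v x *
            (regPow p φ (ε i ^ 4) x * (v x + ε i) ^ (1 - p x)) =
            g x * (regPow p φ (ε i ^ 4) x * (v x ^ (p x - 1) * (v x + ε i) ^ (1 - p x))) := by
          rw [← e1]; ring
        rw [e3, Real.norm_of_nonneg (mul_nonneg hgx.1 (mul_nonneg hr0 h0))]
        refine mul_le_mul (hgx.2.trans (le_abs_self C)) ?_ (mul_nonneg hr0 h0) (abs_nonneg _)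
        exact (mul_le_of_le_one_right hr0 e2).trans hr1
      · rw [Set.indicator_of_notMem hxK,
          regPow_eq_zero (image_eq_zero_of_notMem_tsupport hxK)]
        simp
    · filter_upwards [hmem, hvpos] with x hx hvx
      obtain ⟨hq1, hq2⟩ := hpb x hx
      have hp2 : 0 < p x / 2 := by linarith
      have l1 : Tendsto (fun i => regPow p φ (ε i ^ 4) x) atTop (𝓝 (‖φ x‖ ^ p x)) := by
        have e0 : (φ x ^ 2) ^ (p x / 2) = ‖φ x‖ ^ p x := by
          rw [← sq_abs, ← Real.rpow_natCast, ← Real.rpow_mul (abs_nonneg _), Real.norm_eq_abs]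
          congr 1
          push_cast
          ring
        have a1 := ((hε4.const_add (φ x ^ 2)).rpow_const (p := p x / 2) (Or.inr hp2.le)).sub
          (hε4.rpow_const (p := p x / 2) (Or.inr hp2.le))
        rw [Real.zero_rpow hp2.ne', sub_zero, add_zero, e0] at a1
        exact a1
      have l2 : Tendsto (fun i => (v x + ε i) ^ (1 - p x)) atTop (𝓝 (v x ^ (1 - p x))) := by
        have := (hεlim.const_add (v x)).rpow_const (p := 1 - p x)
          (Or.inl (by rw [add_zero]; exact hvx.ne'))
        rwa [add_zero] at this
      have l3 := (l1.mul l2).const_mul (g x * |v x| ^ (p x - 2) * v x)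
      have e1 : |v x| ^ (p x - 2) * v x * v x ^ (1 - p x) = 1 := by
        rw [abs_of_pos hvx]
        nth_rw 2 [← Real.rpow_one (v x)]
        rw [← Real.rpow_add hvx, ← Real.rpow_add hvx]
        rw [show p x - 2 + 1 + (1 - p x) = 0 by ring, Real.rpow_zero]
      have e2 : g x * |v x| ^ (p x - 2) * v x * (‖φ x‖ ^ p x * v x ^ (1 - p x)) =
          g x * ‖φ x‖ ^ p x := by
        calc _ = g x * ‖φ x‖ ^ p x * (|v x| ^ (p x - 2) * v x * v x ^ (1 - p x)) := by ring
          _ = _ := by rw [e1, mul_one]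
      rwa [e2] at l3
  have hr : Tendsto (fun i => (∫ x in Ω, ‖hGrad X φ x‖ ^ p x ∂μ) +
      pp * ε i * ∫ x in Ω, ‖w x‖ ^ p x ∂μ) atTop (𝓝 (∫ x in Ω, ‖hGrad X φ x‖ ^ p x ∂μ)) := by
    have := ((hεlim.const_mul pp).mul_const (∫ x in Ω, ‖w x‖ ^ p x ∂μ)).const_add
      (∫ x in Ω, ‖hGrad X φ x‖ ^ p x ∂μ)
    simpa using this
  exact le_of_tendsto_of_tendsto' (hlim.const_mul lam) hr fun i =>
    hv.integral_le hX hΩ hp hpm hpb hvpos horth hφ (hε i) (hε1 i)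

/-- The inequality passes from test functions to `W₀^{1,p(·)}`, by density. -/
lemma le_of_forall_isTest [IsLocallyFiniteMeasure μ] (hX : SmoothFields X)
    (hp : ∀ᵐ x ∂μ.restrict Ω, 1 ≤ p x ∧ p x ≤ pp) (hpm : AEMeasurable p (μ.restrict Ω))
    (hgm : AEMeasurable g (μ.restrict Ω)) (hg : ∀ᵐ x ∂μ.restrict Ω, 0 ≤ g x ∧ g x ≤ C)
    (hlam : 0 ≤ lam)
    (h : ∀ φ, IsTest n Ω φ →
      lam * ∫ x in Ω, g x * ‖φ x‖ ^ p x ∂μ ≤ ∫ x in Ω, ‖hGrad X φ x‖ ^ p x ∂μ)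
    {u : M → ℝ} {w : M → EuclideanSpace ℝ (Fin N)} (hu : MemW0 μ X Ω p u w) :
    lam * ∫ x in Ω, g x * ‖u x‖ ^ p x ∂μ ≤ ∫ x in Ω, ‖w x‖ ^ p x ∂μ := by
  obtain ⟨φ, hφ, hφu, hφw⟩ := hu.exists_modular_approx hp hpm hX
  have hφm : ∀ i, MemVarLp μ Ω p (φ i) := fun i => (hφ i).memVarLp hp
  have hφg : ∀ i, MemVarLp μ Ω p (hGrad X (φ i)) := fun i => (hφ i).memVarLp_hGrad hp hX
  set m : ℕ → ℝ := fun i => (modular μ Ω p (fun x => u x - φ i x)).toReal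
  set k : ℕ → ℝ := fun i => (modular μ Ω p (fun x => w x - hGrad X (φ i) x)).toReal
  have hm : Tendsto m atTop (𝓝 0) := by
    simpa [Function.comp_def] using (ENNReal.tendsto_toReal ENNReal.zero_ne_top).comp hφu
  have hk : Tendsto k atTop (𝓝 0) := by
    simpa [Function.comp_def] using (ENNReal.tendsto_toReal ENNReal.zero_ne_top).comp hφw
  -- quasi-convexity gives the inequality up to a factor which tends to `1` as `t → 0`
  have key : ∀ t : ℝ, 0 < t → t < 1 → lam * ∫ x in Ω, g x * ‖u x‖ ^ p x ∂μ ≤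
      (1 - t) ^ (1 - pp) * ((1 - t) ^ (1 - pp) * ∫ x in Ω, ‖w x‖ ^ p x ∂μ) := by
    intro t ht ht1
    have hs : 0 < 1 - t := by linarith
    set κ := (1 - t) ^ (1 - pp)
    have hκ : 0 ≤ κ := by positivity
    have hi : ∀ i, lam * ∫ x in Ω, g x * ‖u x‖ ^ p x ∂μ ≤
        κ * (κ * (∫ x in Ω, ‖w x‖ ^ p x ∂μ) + t ^ (1 - pp) * 1 * k i) +
          lam * (t ^ (1 - pp) * C * m i) := by
      intro i
      have h1 := integral_weight_add_le hp hpm hgm hg (hφm i) (hu.1.1.sub hp hpm (hφm i)) ht ht1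
      simp only [add_sub_cancel] at h1
      have h2 := integral_weight_add_le hp hpm (g := fun _ => 1) (C := 1) aemeasurable_const
        (Eventually.of_forall fun _ => ⟨zero_le_one, le_rfl⟩) hu.1.2.1
        (((hu.1.2.1).sub hp hpm (hφg i)).neg) ht ht1
      rw [modular_neg] at h2
      simp only [neg_sub, add_sub_cancel, one_mul] at h2
      calc lam * ∫ x in Ω, g x * ‖u x‖ ^ p x ∂μ
          ≤ lam * (κ * (∫ x in Ω, g x * ‖φ i x‖ ^ p x ∂μ) + t ^ (1 - pp) * C * m i) :=
            mul_le_mul_of_nonneg_left h1 hlam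
        _ = κ * (lam * ∫ x in Ω, g x * ‖φ i x‖ ^ p x ∂μ) + lam * (t ^ (1 - pp) * C * m i) := by
            ring
        _ ≤ _ := add_le_add (mul_le_mul_of_nonneg_left ((h _ (hφ i)).trans h2) hκ) le_rfl
    have hl : Tendsto (fun i => κ * (κ * (∫ x in Ω, ‖w x‖ ^ p x ∂μ) + t ^ (1 - pp) * 1 * k i) +
          lam * (t ^ (1 - pp) * C * m i)) atTop
        (𝓝 (κ * (κ * (∫ x in Ω, ‖w x‖ ^ p x ∂μ) + t ^ (1 - pp) * 1 * 0) +
          lam * (t ^ (1 - pp) * C * 0))) :=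
      (((hk.const_mul _).const_add _).const_mul _).add ((hm.const_mul _).const_mul _)
    simp only [mul_zero, add_zero] at hl
    exact ge_of_tendsto' hl hi
  have hκ : Tendsto (fun t : ℝ => (1 - t) ^ (1 - pp)) (𝓝[>] 0) (𝓝 1) := by
    have h1 : Tendsto (fun t : ℝ => 1 - t) (𝓝[>] 0) (𝓝 1) := by
      have : Tendsto (fun t : ℝ => 1 - t) (𝓝 0) (𝓝 (1 - 0)) :=
        (continuous_const.sub continuous_id).tendsto 0
      rw [sub_zero] at this
      exact this.mono_left nhdsWithin_le_nhds
    simpa using h1.rpow_const (p := 1 - pp) (Or.inl one_ne_zero)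
  have hl := hκ.mul (hκ.mul_const (∫ x in Ω, ‖w x‖ ^ p x ∂μ))
  simp only [one_mul] at hl
  refine ge_of_tendsto hl ?_
  filter_upwards [Ioo_mem_nhdsGT (zero_lt_one' ℝ)] with t ht
  exact key t ht.1 ht.2

end Inequality

end VarExp

theorem mainTheorem3 {n N : ℕ} {M : Type*} [TopologicalSpace M] [T2Space M]
    [SecondCountableTopology M] [ChartedSpace (EuclideanSpace ℝ (Fin n)) M]
    [IsManifold (𝓡 n) ∞ M] [MeasurableSpace M] [BorelSpace M]
    (μ : Measure M) (hμ : VarExp.IsSmoothVolume n μ)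
    (X : Fin N → (x : M) → TangentSpace (𝓡 n) x) (hX : VarExp.SmoothFields X)
    (Ω : Set M) (hΩ : IsOpen Ω) (hΩne : Ω.Nonempty)
    (p : M → ℝ) (hp : ContMDiffOn (𝓡 n) 𝓘(ℝ, ℝ) 1 p Ω)
    (pm pp : ℝ) (hpm : 1 < pm) (hpb : ∀ x ∈ Ω, pm ≤ p x ∧ p x ≤ pp)
    (g : M → ℝ) (hgm : AEMeasurable g (μ.restrict Ω)) (hgpos : ∀ x ∈ Ω, 0 < g x)
    (C : ℝ) (hgb : ∀ x ∈ Ω, g x ≤ C)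
    (lam : ℝ) (v : M → ℝ) (gradv : M → EuclideanSpace ℝ (Fin N))
    (hv : VarExp.IsSupSolution μ X Ω p g lam v gradv)
    (hvpos : ∀ᵐ x ∂(μ.restrict Ω), 0 < v x)
    (horth : ∀ᵐ x ∂(μ.restrict Ω), inner ℝ (VarExp.hGrad X p x) (gradv x) = 0) :
    (∀ (u : M → ℝ) (gradu : M → EuclideanSpace ℝ (Fin N)), VarExp.MemW0 μ X Ω p u gradu →
      lam * ∫ x in Ω, g x * |u x| ^ p x ∂μ ≤ ∫ x in Ω, ‖gradu x‖ ^ p x ∂μ) ∧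
    lam ≤ VarExp.principalFrequency μ X Ω p g ∧
    (∀ lam' : ℝ, VarExp.IsEigenvalue μ X Ω p g lam' → lam ≤ lam') := by
  have : IsLocallyFiniteMeasure μ := hμ.isLocallyFiniteMeasure
  have hmem : ∀ᵐ x ∂μ.restrict Ω, x ∈ Ω := ae_restrict_mem hΩ.measurableSet
  have hp1 : ∀ᵐ x ∂μ.restrict Ω, 1 ≤ p x ∧ p x ≤ pp := by
    filter_upwards [hmem] with x hx
    exact ⟨hpm.le.trans (hpb x hx).1, (hpb x hx).2⟩
  have hpmeas : AEMeasurable p (μ.restrict Ω) := hp.continuousOn.aemeasurable hΩ.measurableSet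
  have hg0 : ∀ᵐ x ∂μ.restrict Ω, 0 < g x ∧ g x ≤ C := by
    filter_upwards [hmem] with x hx
    exact ⟨hgpos x hx, hgb x hx⟩
  have hg : ∀ᵐ x ∂μ.restrict Ω, 0 ≤ g x ∧ g x ≤ C := hg0.mono fun x hx => ⟨hx.1.le, hx.2⟩
  have main : ∀ (u : M → ℝ) (gradu : M → EuclideanSpace ℝ (Fin N)), VarExp.MemW0 μ X Ω p u gradu →
      lam * ∫ x in Ω, g x * |u x| ^ p x ∂μ ≤ ∫ x in Ω, ‖gradu x‖ ^ p x ∂μ := by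
    intro u gradu hu
    rcases le_total 0 lam with hlam | hlam
    · exact VarExp.le_of_forall_isTest hX hp1 hpmeas hgm hg hlam
        (fun φ hφ => hv.le_of_isTest hX hΩ hp hpm hpb hgm hg hvpos horth hφ) hu
    · refine (mul_nonpos_of_nonpos_of_nonneg hlam (integral_nonneg_of_ae ?_)).trans
        (integral_nonneg fun x => by positivity)
      filter_upwards [hg] with x hx
      exact mul_nonneg hx.1 (by positivity)
  have hpos : ∀ (u : M → ℝ) (gradu : M → EuclideanSpace ℝ (Fin N)),
      VarExp.MemW0 μ X Ω p u gradu → ¬ u =ᵐ[μ.restrict Ω] 0 →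
      0 < ∫ x in Ω, g x * |u x| ^ p x ∂μ := fun u gradu hu hu0 =>
    VarExp.integral_weight_pos hp1 hpmeas hgm hg0 hu.1.1 hu0
  refine ⟨main, le_csInf ?_ ?_, ?_⟩
  · -- the set of Rayleigh quotients is nonempty since `v` is not zero
    refine ⟨_, v, gradv, hv.1, fun h0 => ?_, rfl⟩
    have hfalse : ∀ᵐ _ ∂μ.restrict Ω, False := by
      filter_upwards [h0, hvpos] with x hx hx'
      exact hx'.ne' hx
    rw [eventually_false_iff_eq_bot, ae_eq_bot, Measure.restrict_eq_zero] at hfalse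
    exact (hμ.measure_pos hΩ hΩne).ne' hfalse
  · rintro r ⟨u, gradu, hu, hu0, rfl⟩
    rw [le_div_iff₀ (hpos u gradu hu hu0)]
    exact main u gradu hu
  · rintro lam' ⟨u, gradu, hu, hu0, heq⟩
    have h1 := heq u gradu hu
    have e1 : ∫ x in Ω, ‖gradu x‖ ^ (p x - 2) * inner ℝ (gradu x) (gradu x) ∂μ =
        ∫ x in Ω, ‖gradu x‖ ^ p x ∂μ := by
      refine integral_congr_ae ?_
      filter_upwards [hp1] with x hx
      rw [real_inner_self_eq_norm_sq]
      exact VarExp.rpow_sub_two_mul_sq (norm_nonneg _) (by linarith)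
    have e2 : ∫ x in Ω, g x * |u x| ^ (p x - 2) * u x * u x ∂μ =
        ∫ x in Ω, g x * |u x| ^ p x ∂μ := by
      refine integral_congr_ae ?_
      filter_upwards [hp1] with x hx
      rw [← VarExp.rpow_sub_two_mul_sq (q := p x) (abs_nonneg (u x)) (by linarith), sq_abs]
      ring
    rw [VarExp.weakForm, e1, e2, sub_eq_zero] at h1
    have h2 := main u gradu hu
    rw [h1] at h2
    exact le_of_mul_le_mul_right h2 (hpos u gradu hu hu0)
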